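/- Let $N\in\mathbb N$ and let $p,m,\sigma$ be real numbers with $$N>p>m\ge 2,\qquad p-1\le m<p-1+\frac pN,\qquad p<\sigma<p^*:=\frac{Np}{N-p}.$$ Let $\nu>0$, $C\in\mathbb R$, and let $L:\mathbb R^N\to\mathbb R$, $M:\mathbb R\times\mathbb R^N\to\mathbb R$, $G:\mathbb R\to\mathbb R$ be of class $C^2$, with $G(0)=0$ and $g:=G'$, such that $\xi\mapsto L(\xi)$ and, for each $s$, $\xi\mapsto M(s,\xi)$ are strictly convex and, for all $s\in\mathbb R$, $\xi\in\mathbb R^N$, $$\nu|\xi|^p\le |L(\xi)|\le C|\xi|^p,\quad |L_\xi(\xi)|\le C|\xi|^{p-1},\quad |L_{\xi\xi}(\xi)|\le C|\xi|^{p-2},$$ $$\nu|\xi|^m\le M(s,\xi)\le C|\xi|^m,\quad |M_s(s,\xi)|\le C|\xi|^m,\quad |M_\xi(s,\xi)|\le C|\xi|^{m-1},$$ $$|M_{ss}(s,\xi)|\le C|\xi|^m,\quad |M_{s\xi}(s,\xi)|\le C|\xi|^{m-1},\quad |M_{\xi\xi}(s,\xi)|\le C|\xi|^{m-2},$$ $$M_s(s,\xi)\,s\ge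 0,\qquad |G'(s)|\le C|s|^{\sigma-1},\quad |G''(s)|\le C|s|^{\sigma-2},$$ with the convention $0^0=1$. Put $j(s,\xi):=L(\xi)+M(s,\xi)-G(s)$. Let $\Omega\subset\mathbb R^N$ be an open set with bounded complement (for instance a smooth exterior domain, or $\Omega=\mathbb R^N$), and let $V$ be a bounded continuous function on $\Omega$ with $\inf_\Omega V>0$ and $V(x)\to V_\infty\in\mathbb R$ as $|x|\to\infty$. Let $X:=W^{1,p}_0(\Omega)\cap D^{1,m}_0(\Omega)$ be the completion of the space of smooth functions with compact support in $\Omega$ with respect to the norm $\|u\|_{W^{1,p}(\Omega)}+\|Du\|_{L^m(\Omega)}$, and let $X^*$ be its dual; functions in $X$ are extended by zero to $\mathbb R^N$. For $u\in X$ put $$\phi(u):=\int_\Omega j(u,Du)+\int_\Omega V(x)\frac{|u|^p}p,\qquad \phi_\infty(u):=\int_{\mathbb R^N} j(u,Du)+\int_{\mathbb R^N} V_\infty\frac{|u|^p}p .$$ Let $(u_n)\subset X$ and $u\in X$ be such that $u_n\rightharpoonup u$ weakly in $X$, $u_n\to u$ and $Du_n\to Du$ a.e. in $\Omega$, and suppose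 that there is a sequence $(w_n)\subset X^*$ with $w_n\to0$ in $X^*$ and, for all $n$ and all $v\in X$, $$\int_\Omega j_\xi(u_n,Du_n)\cdot Dv+\int_\Omega j_s(u_n,Du_n)v+\int_\Omega V(x)|u_n|^{p-2}u_nv=\langle w_n,v\rangle .$$ Then the following hold, where all the integrals that occur (and those above) converge absolutely. 1. $\phi'(u)=0$: the functional $\phi$ is Fréchet differentiable at $u$ with derivative $0$, and for all $v\in X$ $$\int_\Omega j_\xi(u,Du)\cdot Dv+\int_\Omega j_s(u,Du)v+\int_\Omega V(x)|u|^{p-2}uv=0.$$ 2. There is a sequence $(\xi_n)\subset X^*$ with $\xi_n\to0$ in $X^*$ such that, for all $n$ and all $v\in X$, $$\begin{aligned}\langle\xi_n,v\rangle={}&\int_\Omega j_s(u_n-u,Du_n-Du)v+\int_\Omega j_\xi(u_n-u,Du_n-Du)\cdot Dv\\&-\int_\Omega j_s(u_n,Du_n)v-\int_\Omega j_\xi(u_n,Du_n)\cdot Dv+\int_\Omega j_s(u,Du)v+\int_\Omega j_\xi(u,Du)\cdot Dv.\end{aligned}$$ 3. There is a sequence $(\zeta_n)\subset X^*$ with $\zeta_n\to0$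 in $X^*$ such that, for all $n$ and all $v\in X$, $$\int_\Omega j_\xi(u_n-u,Du_n-Du)\cdot Dv+\int_\Omega j_s(u_n-u,Du_n-Du)v+\int_\Omega V_\infty|u_n-u|^{p-2}(u_n-u)v=\langle\zeta_n,v\rangle,$$ and $\zeta_n$ is the Fréchet derivative at $u_n-u$ of $\phi_\infty$ on $X$; that is, $\phi_\infty'(u_n-u)\to0$ in $X^*$. -/

import Mathlib

open MeasureTheory Filter Topology Set
open scoped ENNReal Distributions

noncomputable section

/-- Euclidean space `ℝ^N`. -/
abbrev RN (N : ℕ) : Type := EuclideanSpace ℝ (Fin N)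

namespace QuasiLin

/-! ### The space `W^{1,p}_0(Ω) ∩ D^{1,m}_0(Ω)` -/

/-- The ambient Banach space of triples `(u, U, U')` with `u ∈ L^p(ℝ^N)`, `U ∈ L^p(ℝ^N; ℝ^N)`,
`U' ∈ L^m(ℝ^N; ℝ^N)` and norm `(‖u‖_{L^p}^p + ‖U‖_{L^p}^p)^{1/p} + ‖U'‖_{L^m}`. For the triple
`(u, Du, Du)` this is the norm `‖u‖_{W^{1,p}} + ‖Du‖_{L^m}`. -/
abbrev Ambient (N : ℕ) (p m : ℝ) : Type :=
  WithLp 1 (WithLp (ENNReal.ofReal p)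
      (Lp ℝ (ENNReal.ofReal p) (volume : Measure (RN N)) ×
        Lp (RN N) (ENNReal.ofReal p) (volume : Measure (RN N))) ×
    Lp (RN N) (ENNReal.ofReal m) (volume : Measure (RN N)))

theorem memLp_testFunction {N : ℕ} {Ω : TopologicalSpace.Opens (RN N)} (q : ℝ≥0∞)
    (φ : 𝓓(Ω, ℝ)) : MemLp φ q (volume : Measure (RN N)) :=
  φ.continuous.memLp_of_hasCompactSupport φ.hasCompactSupport

theorem memLp_gradient_testFunction {N : ℕ} {Ω : TopologicalSpace.Opens (RN N)} (q : ℝ≥0∞)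
    (φ : 𝓓(Ω, ℝ)) : MemLp (gradient φ) q (volume : Measure (RN N)) := by
  have h1 : Continuous (fderiv ℝ φ) := φ.contDiff.continuous_fderiv (by simp)
  have h2 : Continuous (gradient φ) :=
    (InnerProductSpace.toDual ℝ (RN N)).symm.continuous.comp h1
  have h3 : HasCompactSupport (gradient φ) :=
    (φ.hasCompactSupport.fderiv (𝕜 := ℝ)).comp_left
      (g := (InnerProductSpace.toDual ℝ (RN N)).symm) (map_zero _)
  exact h2.memLp_of_hasCompactSupport h3

theorem gradient_add_testFunction {N : ℕ} {Ω : TopologicalSpace.Opens (RN N)}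
    (φ ψ : 𝓓(Ω, ℝ)) : gradient (φ + ψ : 𝓓(Ω, ℝ)) = gradient φ + gradient ψ := by
  funext x
  have hφ : DifferentiableAt ℝ φ x := (φ.contDiff.differentiable (by simp)) x
  have hψ : DifferentiableAt ℝ ψ x := (ψ.contDiff.differentiable (by simp)) x
  have h : ((φ + ψ : 𝓓(Ω, ℝ)) : RN N → ℝ) = (φ : RN N → ℝ) + (ψ : RN N → ℝ) := rfl
  simp only [gradient, h, fderiv_add hφ hψ, map_add, Pi.add_apply]

theorem gradient_smul_testFunction {N : ℕ} {Ω : TopologicalSpace.Opens (RN N)}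
    (c : ℝ) (φ : 𝓓(Ω, ℝ)) : gradient (c • φ : 𝓓(Ω, ℝ)) = c • gradient φ := by
  funext x
  have hφ : DifferentiableAt ℝ φ x := (φ.contDiff.differentiable (by simp)) x
  have h : ((c • φ : 𝓓(Ω, ℝ)) : RN N → ℝ) = c • (φ : RN N → ℝ) := rfl
  simp only [gradient, h, fderiv_const_smul hφ c, map_smul, Pi.smul_apply]

/-- The linear map `φ ↦ (φ, Dφ, Dφ)` on smooth functions with compact support in `Ω`
(extended by zero to `ℝ^N`). -/
def testEmbedding {N : ℕ} (Ω : TopologicalSpace.Opens (RN N)) (p m : ℝ) :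
    𝓓(Ω, ℝ) →ₗ[ℝ] Ambient N p m where
  toFun φ := WithLp.toLp 1 (WithLp.toLp (ENNReal.ofReal p)
    ((memLp_testFunction (ENNReal.ofReal p) φ).toLp φ,
      (memLp_gradient_testFunction (ENNReal.ofReal p) φ).toLp (gradient φ)),
    (memLp_gradient_testFunction (ENNReal.ofReal m) φ).toLp (gradient φ))
  map_add' φ ψ := by
    simp only [gradient_add_testFunction]
    rfl
  map_smul' c φ := by
    simp only [gradient_smul_testFunction]
    rfl

/-- `W^{1,p}_0(Ω) ∩ D^{1,m}_0(Ω)`: the completion of the smooth functions with compact support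
in `Ω` for the norm `‖u‖_{W^{1,p}} + ‖Du‖_{L^m}`, realised as the closure of the set of all
`(φ, Dφ, Dφ)`. Its elements are functions on `ℝ^N`, the extension by zero out of `Ω` being
built in. -/
abbrev X {N : ℕ} (Ω : TopologicalSpace.Opens (RN N)) (p m : ℝ)
    [Fact (1 ≤ ENNReal.ofReal p)] [Fact (1 ≤ ENNReal.ofReal m)] :
    Submodule ℝ (Ambient N p m) :=
  (LinearMap.range (testEmbedding Ω p m)).topologicalClosure

section

variable {N : ℕ} {Ω : TopologicalSpace.Opens (RN N)} {p m : ℝ}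
  [Fact (1 ≤ ENNReal.ofReal p)] [Fact (1 ≤ ENNReal.ofReal m)]

/-- A representative of `u`, defined on `ℝ^N`. -/
def val (u : X Ω p m) : RN N → ℝ := (u : Ambient N p m).fst.fst

/-- A representative of the weak gradient `Du`, defined on `ℝ^N`. -/
def grad (u : X Ω p m) : RN N → RN N := (u : Ambient N p m).fst.snd

end

/-! ### The integrand -/

/-- `j(s, ξ) = L(ξ) + M(s, ξ) - G(s)`. -/
def jFun {N : ℕ} (L : RN N → ℝ) (M : ℝ → RN N → ℝ) (G : ℝ → ℝ) (s : ℝ) (ξ : RN N) : ℝ :=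
  L ξ + M s ξ - G s

/-- Partial derivative in the scalar variable, `f_s(s, ξ)`. -/
def dS {N : ℕ} (f : ℝ → RN N → ℝ) (s : ℝ) (ξ : RN N) : ℝ := deriv (fun t => f t ξ) s

/-- Partial gradient in the vector variable, `f_ξ(s, ξ)`. -/
def dXi {N : ℕ} (f : ℝ → RN N → ℝ) (s : ℝ) (ξ : RN N) : RN N := gradient (f s) ξ

/-- The standing assumptions on the exponents and on `L`, `M`, `G` (super-quadratic case). -/
structure Assumptions (N : ℕ) (p m σ ν C : ℝ) (L : RN N → ℝ) (M : ℝ → RN N → ℝ)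
    (G : ℝ → ℝ) : Prop where
  two_le_m : 2 ≤ m
  m_lt_p : m < p
  p_lt_N : p < N
  m_ge : p - 1 ≤ m
  m_lt : m < p - 1 + p / N
  p_lt_σ : p < σ
  σ_lt : σ < N * p / (N - p)
  ν_pos : 0 < ν
  L_C2 : ContDiff ℝ 2 L
  M_C2 : ContDiff ℝ 2 (fun z : ℝ × RN N => M z.1 z.2)
  G_C2 : ContDiff ℝ 2 G
  L_convex : StrictConvexOn ℝ univ L
  M_convex : ∀ s, StrictConvexOn ℝ univ (M s)
  L_lower : ∀ ξ, ν * ‖ξ‖ ^ p ≤ |L ξ|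
  L_upper : ∀ ξ, |L ξ| ≤ C * ‖ξ‖ ^ p
  L_xi : ∀ ξ, ‖gradient L ξ‖ ≤ C * ‖ξ‖ ^ (p - 1)
  L_xi_xi : ∀ ξ, ‖fderiv ℝ (gradient L) ξ‖ ≤ C * ‖ξ‖ ^ (p - 2)
  M_lower : ∀ s ξ, ν * ‖ξ‖ ^ m ≤ M s ξ
  M_upper : ∀ s ξ, M s ξ ≤ C * ‖ξ‖ ^ m
  M_s : ∀ s ξ, |dS M s ξ| ≤ C * ‖ξ‖ ^ m
  M_xi : ∀ s ξ, ‖dXi M s ξ‖ ≤ C * ‖ξ‖ ^ (m - 1)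
  M_s_s : ∀ s ξ, |dS (dS M) s ξ| ≤ C * ‖ξ‖ ^ m
  M_s_xi : ∀ s ξ, ‖dXi (dS M) s ξ‖ ≤ C * ‖ξ‖ ^ (m - 1)
  M_xi_xi : ∀ s ξ, ‖fderiv ℝ (dXi M s) ξ‖ ≤ C * ‖ξ‖ ^ (m - 2)
  M_sign : ∀ s ξ, 0 ≤ dS M s ξ * s
  G_zero : G 0 = 0
  G_s : ∀ s, |deriv G s| ≤ C * |s| ^ (σ - 1)
  G_s_s : ∀ s, |deriv (deriv G) s| ≤ C * |s| ^ (σ - 2)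

/-- The standing assumptions on `Ω`, `V` and `V_∞`. -/
structure PotentialAssumptions {N : ℕ} (Ω : TopologicalSpace.Opens (RN N)) (V : RN N → ℝ)
    (Vinf : ℝ) : Prop where
  bounded_compl : Bornology.IsBounded ((Ω : Set (RN N))ᶜ)
  continuousOn : ContinuousOn V Ω
  bddAbove : BddAbove (V '' Ω)
  pos : ∃ V₀ : ℝ, 0 < V₀ ∧ ∀ x ∈ Ω, V₀ ≤ V x
  tendsto : Tendsto V (Bornology.cobounded (RN N) ⊓ 𝓟 (Ω : Set (RN N))) (𝓝 Vinf)

/-! ### The functionals and the weak forms -/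

section

variable {N : ℕ} {Ω : TopologicalSpace.Opens (RN N)} {p m : ℝ}
  [Fact (1 ≤ ENNReal.ofReal p)] [Fact (1 ≤ ENNReal.ofReal m)]

/-- `φ(u) = ∫_Ω j(u, Du) + ∫_Ω V(x) |u|^p / p` on `W^{1,p}_0(Ω) ∩ D^{1,m}_0(Ω)`. -/
def phi (j : ℝ → RN N → ℝ) (V : RN N → ℝ) (u : X Ω p m) : ℝ :=
  (∫ x in (Ω : Set (RN N)), j (val u x) (grad u x)) +
    ∫ x in (Ω : Set (RN N)), V x * (|val u x| ^ p / p)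

/-- `φ_∞(u) = ∫_{ℝ^N} j(u, Du) + ∫_{ℝ^N} V_∞ |u|^p / p` for `u` in `W^{1,p}_0(Ω) ∩ D^{1,m}_0(Ω)`,
regarded as a function on `ℝ^N` after extension by zero. -/
def phiInf (j : ℝ → RN N → ℝ) (Vinf : ℝ) (u : X Ω p m) : ℝ :=
  (∫ x, j (val u x) (grad u x)) + ∫ x, Vinf * (|val u x| ^ p / p)

/-- `∫_Ω j_ξ(u, Du) · Dv`. -/
def formXi (j : ℝ → RN N → ℝ) (u v : X Ω p m) : ℝ :=
  ∫ x in (Ω : Set (RN N)), inner ℝ (dXi j (val u x) (grad u x)) (grad v x)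

/-- `∫_Ω j_s(u, Du) v`. -/
def formS (j : ℝ → RN N → ℝ) (u v : X Ω p m) : ℝ :=
  ∫ x in (Ω : Set (RN N)), dS j (val u x) (grad u x) * val v x

/-- `∫_Ω W(x) |u|^{p-2} u v`. -/
def formV (W : RN N → ℝ) (u v : X Ω p m) : ℝ :=
  ∫ x in (Ω : Set (RN N)), W x * |val u x| ^ (p - 2) * val u x * val v x

/-- All integrals in `φ(u)`, `φ_∞(u)` and in the three forms at `(u, v)` converge absolutely. -/
def IntegralsConverge (j : ℝ → RN N → ℝ) (V : RN N → ℝ) (u v : X Ω p m) : Prop :=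
  Integrable (fun x => j (val u x) (grad u x)) ∧
  IntegrableOn (fun x => V x * (|val u x| ^ p / p)) Ω ∧
  Integrable (fun x => |val u x| ^ p) ∧
  IntegrableOn (fun x => inner ℝ (dXi j (val u x) (grad u x)) (grad v x)) Ω ∧
  IntegrableOn (fun x => dS j (val u x) (grad u x) * val v x) Ω ∧
  IntegrableOn (fun x => V x * |val u x| ^ (p - 2) * val u x * val v x) Ω ∧
  IntegrableOn (fun x => |val u x| ^ (p - 2) * val u x * val v x) Ω

end

end QuasiLin

end

noncomputable section

namespace QuasiLin

/-! ### Elementary inequalities for powers -/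

theorem rpow_le_add_rpow {x α k γ : ℝ} (hx : 0 ≤ x) (hα : 0 < α) (h1 : α ≤ k) (h2 : k ≤ γ) :
    x ^ k ≤ x ^ α + x ^ γ := by
  have ha := Real.rpow_nonneg hx α
  have hg := Real.rpow_nonneg hx γ
  rcases le_total x 1 with h | h
  · have := Real.rpow_le_rpow_of_exponent_ge_of_imp hx h h1 (fun _ h0 => by linarith)
    linarith
  · have := Real.rpow_le_rpow_of_exponent_le h h2
    linarith

theorem exists_rpow_le_mul_rpow_add {k γ ε : ℝ} (hk : 0 < k) (hkγ : k < γ) (hε : 0 < ε) :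
    ∃ C : ℝ, 0 < C ∧ ∀ x : ℝ, 0 ≤ x → x ^ k ≤ ε * x ^ γ + C := by
  obtain ⟨R, hR0, hR⟩ : ∃ R : ℝ, 0 < R ∧ 1 ≤ ε * R ^ (γ - k) := by
    refine ⟨(1 / ε) ^ (1 / (γ - k)), by positivity, ?_⟩
    rw [← Real.rpow_mul (by positivity), one_div_mul_cancel (by linarith), Real.rpow_one]
    field_simp; rfl
  refine ⟨R ^ k, by positivity, fun x hx => ?_⟩
  have hg := Real.rpow_nonneg hx γ
  rcases le_total x R with h | h
  · have := Real.rpow_le_rpow hx h hk.le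
    nlinarith
  · have hx0 : 0 < x := by linarith
    have h1 : x ^ γ = x ^ k * x ^ (γ - k) := by rw [← Real.rpow_add hx0]; congr 1; ring
    have h2 : R ^ (γ - k) ≤ x ^ (γ - k) := Real.rpow_le_rpow hR0.le h (by linarith)
    have h3 : 1 ≤ ε * x ^ (γ - k) := hR.trans (by gcongr)
    have h4 := Real.rpow_nonneg hx k
    have h5 : 0 < R ^ k := by positivity
    rw [h1]
    nlinarith

theorem exists_add_rpow_mul_le {k ε : ℝ} (hk : 1 ≤ k) (hε : 0 < ε) :
    ∃ C : ℝ, 0 < C ∧ ∀ x y : ℝ, 0 ≤ x → 0 ≤ y →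
      (x + y) ^ (k - 1) * y ≤ ε * x ^ k + C * y ^ k := by
  set δ : ℝ := min 1 (ε / 2 ^ (k - 1)) with hδ
  have hδ0 : 0 < δ := by positivity
  have split : ∀ z : ℝ, 0 ≤ z → z ^ (k - 1) * z = z ^ k := by
    intro z hz
    rcases hz.eq_or_lt with rfl | hz
    · rw [mul_zero, Real.zero_rpow (by linarith)]
    · rw [← Real.rpow_add_one hz.ne']; congr 1; ring
  refine ⟨(1 / δ + 1) ^ (k - 1), by positivity, fun x y hx hy => ?_⟩
  have hxk := Real.rpow_nonneg hx k
  have hyk := Real.rpow_nonneg hy k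
  rcases le_total y (δ * x) with h | h
  · have h1 : y ≤ x := h.trans (by nlinarith [min_le_left 1 (ε / 2 ^ (k - 1))])
    have h2 : (x + y) ^ (k - 1) ≤ (2 * x) ^ (k - 1) :=
      Real.rpow_le_rpow (by positivity) (by linarith) (by linarith)
    have h3 : (2 : ℝ) ^ (k - 1) * δ ≤ ε := by
      calc (2 : ℝ) ^ (k - 1) * δ ≤ 2 ^ (k - 1) * (ε / 2 ^ (k - 1)) := by
            gcongr; exact min_le_right _ _
        _ = ε := by field_simp
    calc (x + y) ^ (k - 1) * y ≤ (2 * x) ^ (k - 1) * (δ * x) := by gcongr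
      _ = (2 ^ (k - 1) * δ) * x ^ k := by
          rw [Real.mul_rpow (by norm_num) hx, ← split x hx]; ring
      _ ≤ ε * x ^ k := by gcongr
      _ ≤ _ := by have : 0 ≤ (1 / δ + 1) ^ (k - 1) * y ^ k := by positivity
                  linarith
  · have h1 : x ≤ y / δ := by rw [le_div_iff₀ hδ0]; linarith
    have h2 : (x + y) ^ (k - 1) ≤ ((1 / δ + 1) * y) ^ (k - 1) := by
      apply Real.rpow_le_rpow (by positivity) _ (by linarith)
      rw [add_mul, one_mul, one_div_mul_eq_div]; linarith
    calc (x + y) ^ (k - 1) * y ≤ ((1 / δ + 1) * y) ^ (k - 1) * y := by gcongr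
      _ = (1 / δ + 1) ^ (k - 1) * y ^ k := by
          rw [Real.mul_rpow (by positivity) hy, ← split y hy]; ring
      _ ≤ _ := by have : 0 ≤ ε * x ^ k := by positivity
                  linarith

/-- Young inequality with a small constant on the first term. -/
theorem exists_rpow_mul_rpow_le {a b q r ε : ℝ} (ha : 0 < a) (hb : 0 < b) (hq : 0 < q) (hr : 0 < r)
    (h : a / q + b / r = 1) (hε : 0 < ε) :
    ∃ C : ℝ, 0 < C ∧ ∀ x y : ℝ, 0 ≤ x → 0 ≤ y → x ^ a * y ^ b ≤ ε * x ^ q + C * y ^ r := by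
  have hconj : (q / a).HolderConjugate (r / b) := by
    refine ⟨?_, by positivity, by positivity⟩
    rw [inv_div, inv_div, inv_one, h]
  obtain ⟨δ, hδ0, hδ⟩ : ∃ δ : ℝ, 0 < δ ∧ δ ^ (q / a) / (q / a) = ε := by
    refine ⟨(ε * (q / a)) ^ (a / q), by positivity, ?_⟩
    rw [← Real.rpow_mul (by positivity), div_mul_div_comm, mul_comm a q, div_self (by positivity),
      Real.rpow_one]
    field_simp
  refine ⟨(1 / δ) ^ (r / b) / (r / b), by positivity, fun x y hx hy => ?_⟩
  have hy' := Real.rpow_nonneg hy b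
  have hx' := Real.rpow_nonneg hx a
  have := Real.young_inequality_of_nonneg (mul_nonneg hδ0.le hx')
    (mul_nonneg (one_div_pos.2 hδ0).le hy') hconj
  rw [Real.mul_rpow hδ0.le hx', Real.mul_rpow (one_div_pos.2 hδ0).le hy', ← Real.rpow_mul hx,
    ← Real.rpow_mul hy, mul_div_cancel₀ _ ha.ne', mul_div_cancel₀ _ hb.ne'] at this
  calc x ^ a * y ^ b = δ * x ^ a * (1 / δ * y ^ b) := by field_simp
    _ ≤ _ := this
    _ = _ := by rw [← hδ]; ring

theorem exists_rpow_sub_one_mul_le {q ε : ℝ} (hq : 1 < q) (hε : 0 < ε) :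
    ∃ C : ℝ, 0 < C ∧ ∀ x y : ℝ, 0 ≤ x → 0 ≤ y →
      x ^ (q - 1) * y ≤ ε * x ^ q + C * y ^ q ∧ x ^ (q - 1) * y ≤ ε * y ^ q + C * x ^ q := by
  have h0 : 0 < q := by linarith
  obtain ⟨C₁, h1, H1⟩ := exists_rpow_mul_rpow_le (a := q - 1) (b := 1) (q := q) (r := q)
    (by linarith) one_pos h0 h0 (by field_simp; ring) hε
  obtain ⟨C₂, h2, H2⟩ := exists_rpow_mul_rpow_le (a := 1) (b := q - 1) (q := q) (r := q)
    one_pos (by linarith) h0 h0 (by field_simp; ring) hε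
  refine ⟨C₁ + C₂, by positivity, fun x y hx hy => ?_⟩
  have hx' := Real.rpow_nonneg hx q
  have hy' := Real.rpow_nonneg hy q
  have a1 := H1 x y hx hy
  have a2 := H2 y x hy hx
  rw [Real.rpow_one] at a1 a2
  constructor <;> nlinarith

/-! ### The growth functions -/

/-- The critical Sobolev exponent `Np/(N-p)`. -/
def pstar (N : ℕ) (p : ℝ) : ℝ := N * p / (N - p)

/-- Growth function of the energy. -/
def psi (N : ℕ) (p m : ℝ) (s : ℝ) (a : RN N) : ℝ :=
  |s| ^ p + |s| ^ pstar N p + ‖a‖ ^ p + ‖a‖ ^ m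

/-- Growth function of the derivative of the integrand in the scalar variable. -/
def phiS (N : ℕ) (p : ℝ) (s : ℝ) (a : RN N) : ℝ :=
  |s| ^ (p - 1) + |s| ^ (pstar N p - 1) + ‖a‖ ^ (p - 1) + ‖a‖ ^ (p - 1 + p / N)

/-- Growth function of the derivative of the integrand in the vector variable. -/
def phiX (N : ℕ) (p m : ℝ) (s : ℝ) (a : RN N) : ℝ :=
  |s| ^ (p - 1) + ‖a‖ ^ (p - 1) + ‖a‖ ^ (m - 1)

/-- The constraints on the exponents that matter for the growth functions. -/
structure Exponents (N : ℕ) (p m : ℝ) : Prop where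
  two_le_m : 2 ≤ m
  m_lt_p : m < p
  p_lt_N : p < N
  m_ge : p - 1 ≤ m
  m_lt : m < p - 1 + p / N

variable {N : ℕ} {p m : ℝ}

theorem psi_nonneg (s : ℝ) (a : RN N) : 0 ≤ psi N p m s a := by unfold psi; positivity
theorem phiS_nonneg (s : ℝ) (a : RN N) : 0 ≤ phiS N p s a := by unfold phiS; positivity
theorem phiX_nonneg (s : ℝ) (a : RN N) : 0 ≤ phiX N p m s a := by unfold phiX; positivity

namespace Exponents

theorem two_lt_p (h : Exponents N p m) : 2 < p := h.two_le_m.trans_lt h.m_lt_p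

theorem N_pos (h : Exponents N p m) : (0 : ℝ) < N := by linarith [h.two_lt_p, h.p_lt_N]

theorem p_lt_pstar (h : Exponents N p m) : p < pstar N p := by
  have h2 := h.two_lt_p
  have h3 := h.p_lt_N
  rw [pstar, lt_div_iff₀ (by linarith)]
  nlinarith

theorem conj (h : Exponents N p m) : (p - 1 + p / N) / p + 1 / pstar N p = 1 := by
  have h2 := h.two_lt_p
  have h3 := h.p_lt_N
  have hN := h.N_pos
  have : (N : ℝ) - p ≠ 0 := by linarith
  rw [pstar]
  field_simp
  ring

theorem continuous_psi (h : Exponents N p m) :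
    Continuous (fun z : ℝ × RN N => psi N p m z.1 z.2) := by
  have h1 := h.two_le_m
  have h2 := h.two_lt_p
  have h3 := h.p_lt_pstar
  unfold psi
  refine (((?_ : Continuous _).add ?_).add ?_).add ?_ <;>
  · refine Continuous.rpow_const (by fun_prop) fun _ => Or.inr (by linarith)

theorem continuous_phiS (h : Exponents N p m) :
    Continuous (fun z : ℝ × RN N => phiS N p z.1 z.2) := by
  have h1 := h.two_le_m
  have h2 := h.two_lt_p
  have h3 := h.p_lt_pstar
  have h4 := h.m_lt
  unfold phiS
  refine (((?_ : Continuous _).add ?_).add ?_).add ?_ <;>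
  · refine Continuous.rpow_const (by fun_prop) fun _ => Or.inr (by linarith)

theorem continuous_phiX (h : Exponents N p m) :
    Continuous (fun z : ℝ × RN N => phiX N p m z.1 z.2) := by
  have h1 := h.two_le_m
  have h2 := h.two_lt_p
  unfold phiX
  refine ((?_ : Continuous _).add ?_).add ?_ <;>
  · refine Continuous.rpow_const (by fun_prop) fun _ => Or.inr (by linarith)

/-- Young inequality for the growth functions, with the small constant on either side. -/
theorem young (h : Exponents N p m) {ε : ℝ} (hε : 0 < ε) :
    ∃ C : ℝ, 0 < C ∧ ∀ (s t : ℝ) (a b : RN N),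
      phiS N p s a * |t| + phiX N p m s a * ‖b‖ ≤ ε * psi N p m t b + C * psi N p m s a ∧
      phiS N p s a * |t| + phiX N p m s a * ‖b‖ ≤ ε * psi N p m s a + C * psi N p m t b := by
  have h1 := h.two_le_m
  have h2 := h.two_lt_p
  have h3 := h.p_lt_pstar
  have h4 := h.m_lt
  have hε' : 0 < ε / 4 := by positivity
  obtain ⟨C₁, c1, H1⟩ := exists_rpow_sub_one_mul_le (q := p) (by linarith) hε'
  obtain ⟨C₂, c2, H2⟩ := exists_rpow_sub_one_mul_le (q := pstar N p) (by linarith) hε'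
  obtain ⟨C₃, c3, H3⟩ := exists_rpow_sub_one_mul_le (q := m) (by linarith) hε'
  obtain ⟨C₄, c4, H4⟩ := exists_rpow_mul_rpow_le (a := p - 1 + p / N) (b := 1) (q := p)
    (r := pstar N p) (by linarith) one_pos (by linarith) (by linarith) h.conj hε'
  obtain ⟨C₅, c5, H5⟩ := exists_rpow_mul_rpow_le (a := 1) (b := p - 1 + p / N) (q := pstar N p)
    (r := p) one_pos (by linarith) (by linarith) (by linarith) (by rw [add_comm]; exact h.conj) hε'
  set K := C₁ + C₂ + C₃ + C₄ + C₅ with hK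
  have up : ∀ {x y z C : ℝ}, x ≤ y + C * z → 0 ≤ z → C ≤ K → x ≤ y + K * z := by
    intro x y z C h1 h2 h3
    nlinarith
  refine ⟨4 * K, by positivity, fun s t a b => ?_⟩
  have r : ∀ {x : ℝ} (k : ℝ), 0 ≤ x → 0 ≤ x ^ k := fun k hx => Real.rpow_nonneg hx k
  have s0 := abs_nonneg s
  have t0 := abs_nonneg t
  have a0 := norm_nonneg a
  have b0 := norm_nonneg b
  have l1 : C₁ ≤ K := by linarith
  have l2 : C₂ ≤ K := by linarith
  have l3 : C₃ ≤ K := by linarith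
  have l4 : C₄ ≤ K := by linarith
  have l5 : C₅ ≤ K := by linarith
  have hK0 : 0 < K := by positivity
  have pos : ∀ {x : ℝ} (k : ℝ), 0 ≤ x → 0 ≤ ε * x ^ k ∧ 0 ≤ K * x ^ k :=
    fun k hx => ⟨by positivity, by positivity⟩
  have n1 := pos p s0
  have n2 := pos (pstar N p) s0
  have n3 := pos p a0
  have n4 := pos m a0
  have n5 := pos p t0
  have n6 := pos (pstar N p) t0
  have n7 := pos p b0
  have n8 := pos m b0
  have e4 := up (H4 ‖a‖ |t| a0 t0) (r _ t0) l4
  have e5 := up (H5 |t| ‖a‖ t0 a0) (r _ a0) l5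
  rw [Real.rpow_one] at e4 e5
  unfold phiS phiX psi
  constructor
  · have e1 := up (H1 |s| |t| s0 t0).2 (r _ s0) l1
    have e2 := up (H2 |s| |t| s0 t0).2 (r _ s0) l2
    have e3 := up (H1 ‖a‖ |t| a0 t0).2 (r _ a0) l1
    have e6 := up (H1 |s| ‖b‖ s0 b0).2 (r _ s0) l1
    have e7 := up (H1 ‖a‖ ‖b‖ a0 b0).2 (r _ a0) l1
    have e8 := up (H3 ‖a‖ ‖b‖ a0 b0).2 (r _ a0) l3
    linarith
  · have e1 := up (H1 |s| |t| s0 t0).1 (r _ t0) l1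
    have e2 := up (H2 |s| |t| s0 t0).1 (r _ t0) l2
    have e3 := up (H1 ‖a‖ |t| a0 t0).1 (r _ t0) l1
    have e6 := up (H1 |s| ‖b‖ s0 b0).1 (r _ b0) l1
    have e7 := up (H1 ‖a‖ ‖b‖ a0 b0).1 (r _ b0) l1
    have e8 := up (H3 ‖a‖ ‖b‖ a0 b0).1 (r _ b0) l3
    linarith

theorem rpow_m_le (h : Exponents N p m) {x : ℝ} (hx : 0 ≤ x) :
    x ^ m ≤ x ^ (p - 1) + x ^ (p - 1 + p / N) :=
  rpow_le_add_rpow hx (by linarith [h.two_lt_p]) h.m_ge h.m_lt.le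

end Exponents

/-! ### The space `X` -/

section Space

variable {N : ℕ} {Ω : TopologicalSpace.Opens (RN N)} {p m : ℝ}
  [Fact (1 ≤ ENNReal.ofReal p)] [Fact (1 ≤ ENNReal.ofReal m)]

theorem exists_subseq_ae_of_tendsto_Lp {α E : Type*} [MeasurableSpace α] {μ : Measure α}
    [NormedAddCommGroup E] {q : ℝ≥0∞} [Fact (1 ≤ q)] {f : ℕ → Lp E q μ} {g : Lp E q μ}
    (h : Tendsto f atTop (𝓝 g)) :
    ∃ ns : ℕ → ℕ, StrictMono ns ∧ ∀ᵐ x ∂μ, Tendsto (fun k => f (ns k) x) atTop (𝓝 (g x)) :=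
  (tendstoInMeasure_of_tendsto_Lp h).exists_seq_tendsto_ae

/-- Every element of `X` is the limit of test functions, in norm and almost everywhere together
with the gradients. -/
theorem exists_testFunction_approx (v : X Ω p m) :
    ∃ φ : ℕ → 𝓓(Ω, ℝ),
      Tendsto (fun k => testEmbedding Ω p m (φ k)) atTop (𝓝 (v : Ambient N p m)) ∧
      (∀ᵐ x, Tendsto (fun k => φ k x) atTop (𝓝 (val v x))) ∧
      (∀ᵐ x, Tendsto (fun k => gradient (φ k) x) atTop (𝓝 (grad v x))) ∧
      (∀ᵐ x, Tendsto (fun k => gradient (φ k) x) atTop (𝓝 ((v : Ambient N p m).snd x))) := by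
  have hv : (v : Ambient N p m) ∈ closure (LinearMap.range (testEmbedding Ω p m) :
      Set (Ambient N p m)) := v.2
  obtain ⟨f, hf, hlim⟩ := mem_closure_iff_seq_limit.1 hv
  choose φ hφ using hf
  have hφ' : ∀ k, f k = testEmbedding Ω p m (φ k) := fun k => (hφ k).symm
  have c1 : Tendsto (fun k => (f k).fst.fst) atTop (𝓝 (v : Ambient N p m).fst.fst) :=
    (((WithLp.fstL (ENNReal.ofReal p) ℝ _ _).continuous.comp
      (WithLp.fstL 1 ℝ _ _).continuous).tendsto _).comp hlim
  have c2 : Tendsto (fun k => (f k).fst.snd) atTop (𝓝 (v : Ambient N p m).fst.snd) :=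
    (((WithLp.sndL (ENNReal.ofReal p) ℝ _ _).continuous.comp
      (WithLp.fstL 1 ℝ _ _).continuous).tendsto _).comp hlim
  have c3 : Tendsto (fun k => (f k).snd) atTop (𝓝 (v : Ambient N p m).snd) :=
    ((WithLp.sndL 1 ℝ _ _).continuous.tendsto _).comp hlim
  obtain ⟨n1, m1, h1⟩ := exists_subseq_ae_of_tendsto_Lp c1
  obtain ⟨n2, m2, h2⟩ := exists_subseq_ae_of_tendsto_Lp (c2.comp m1.tendsto_atTop)
  obtain ⟨n3, m3, h3⟩ :=
    exists_subseq_ae_of_tendsto_Lp (c3.comp (m1.tendsto_atTop.comp m2.tendsto_atTop))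
  have a1 : ∀ᵐ x, ∀ k, ((f k).fst.fst : RN N → ℝ) x = φ k x := by
    rw [ae_all_iff]; intro k; rw [hφ' k]
    exact (memLp_testFunction (ENNReal.ofReal p) (φ k)).coeFn_toLp
  have a2 : ∀ᵐ x, ∀ k, ((f k).fst.snd : RN N → RN N) x = gradient (φ k) x := by
    rw [ae_all_iff]; intro k; rw [hφ' k]
    exact (memLp_gradient_testFunction (ENNReal.ofReal p) (φ k)).coeFn_toLp
  have a3 : ∀ᵐ x, ∀ k, ((f k).snd : RN N → RN N) x = gradient (φ k) x := by
    rw [ae_all_iff]; intro k; rw [hφ' k]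
    exact (memLp_gradient_testFunction (ENNReal.ofReal m) (φ k)).coeFn_toLp
  refine ⟨fun k => φ (n1 (n2 (n3 k))), ?_, ?_, ?_, ?_⟩
  · simp only [← hφ']
    exact hlim.comp (m1.tendsto_atTop.comp (m2.tendsto_atTop.comp m3.tendsto_atTop))
  · filter_upwards [h1, a1] with x hx ha
    refine (hx.comp (m2.tendsto_atTop.comp m3.tendsto_atTop)).congr fun k => ?_
    exact ha _
  · filter_upwards [h2, a2] with x hx ha
    refine (hx.comp m3.tendsto_atTop).congr fun k => ?_
    exact ha _
  · filter_upwards [h3, a3] with x hx ha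
    refine hx.congr fun k => ?_
    exact ha _

theorem snd_ae_eq_grad (v : X Ω p m) : ((v : Ambient N p m).snd : RN N → RN N) =ᵐ[volume] grad v := by
  obtain ⟨φ, -, -, h1, h2⟩ := exists_testFunction_approx v
  filter_upwards [h1, h2] with x hx hx'
  exact tendsto_nhds_unique hx' hx

theorem ae_eq_zero_of_notMem (v : X Ω p m) :
    ∀ᵐ x, x ∉ (Ω : Set (RN N)) → val v x = 0 ∧ grad v x = 0 := by
  obtain ⟨φ, -, h0, h1, -⟩ := exists_testFunction_approx v
  filter_upwards [h0, h1] with x hx hx' hxΩ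
  have hs : ∀ k, x ∉ tsupport (φ k) := fun k hk => hxΩ ((φ k).tsupport_subset hk)
  constructor
  · refine tendsto_nhds_unique hx (tendsto_const_nhds.congr fun k => ?_)
    exact (image_eq_zero_of_notMem_tsupport (hs k)).symm
  · refine tendsto_nhds_unique hx' (tendsto_const_nhds.congr fun k => ?_)
    have : fderiv ℝ (φ k) x = 0 := by
      by_contra h
      exact hs k (support_fderiv_subset ℝ h)
    simp [gradient, this]

theorem aestronglyMeasurable_val (v : X Ω p m) : AEStronglyMeasurable (val v) volume :=
  Lp.aestronglyMeasurable _

theorem aestronglyMeasurable_grad (v : X Ω p m) : AEStronglyMeasurable (grad v) volume :=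
  Lp.aestronglyMeasurable _

theorem val_add (u v : X Ω p m) : ∀ᵐ x, val (u + v) x = val u x + val v x :=
  Lp.coeFn_add _ _

theorem grad_add (u v : X Ω p m) : ∀ᵐ x, grad (u + v) x = grad u x + grad v x :=
  Lp.coeFn_add _ _

theorem val_sub (u v : X Ω p m) : ∀ᵐ x, val (u - v) x = val u x - val v x :=
  Lp.coeFn_sub _ _

theorem grad_sub (u v : X Ω p m) : ∀ᵐ x, grad (u - v) x = grad u x - grad v x :=
  Lp.coeFn_sub _ _

theorem val_smul (c : ℝ) (v : X Ω p m) : ∀ᵐ x, val (c • v) x = c * val v x :=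
  Lp.coeFn_smul _ _

theorem grad_smul (c : ℝ) (v : X Ω p m) : ∀ᵐ x, grad (c • v) x = c • grad v x :=
  Lp.coeFn_smul _ _

theorem eLpNorm_val_le (v : X Ω p m) :
    eLpNorm (val v) (ENNReal.ofReal p) volume ≤ ENNReal.ofReal ‖v‖ := by
  have h := (WithLp.norm_fst_le _ (v : Ambient N p m).fst).trans (WithLp.norm_fst_le _ (v : Ambient N p m))
  rw [Lp.norm_def] at h
  refine (ENNReal.ofReal_toReal (Lp.memLp (v : Ambient N p m).fst.fst).2.ne).symm.le.trans ?_
  exact ENNReal.ofReal_le_ofReal h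

theorem eLpNorm_grad_le (v : X Ω p m) :
    eLpNorm (grad v) (ENNReal.ofReal p) volume ≤ ENNReal.ofReal ‖v‖ := by
  have h := (WithLp.norm_snd_le _ (v : Ambient N p m).fst).trans (WithLp.norm_fst_le _ (v : Ambient N p m))
  rw [Lp.norm_def] at h
  refine (ENNReal.ofReal_toReal (Lp.memLp (v : Ambient N p m).fst.snd).2.ne).symm.le.trans ?_
  exact ENNReal.ofReal_le_ofReal h

theorem eLpNorm_grad_le' (v : X Ω p m) :
    eLpNorm (grad v) (ENNReal.ofReal m) volume ≤ ENNReal.ofReal ‖v‖ := by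
  have h := WithLp.norm_snd_le _ (v : Ambient N p m)
  rw [Lp.norm_def] at h
  rw [← eLpNorm_congr_ae (snd_ae_eq_grad v),
    ← ENNReal.ofReal_toReal (Lp.memLp (v : Ambient N p m).snd).2.ne]
  exact ENNReal.ofReal_le_ofReal h

/-- The Sobolev inequality. -/
theorem exists_eLpNorm_val_pstar_le (h : Exponents N p m) :
    ∃ K : ℝ, 0 < K ∧ ∀ v : X Ω p m,
      eLpNorm (val v) (ENNReal.ofReal (pstar N p)) volume ≤ ENNReal.ofReal (K * ‖v‖) := by
  have hp := h.two_lt_p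
  have hP := h.p_lt_pstar
  have hN := h.N_pos
  have hpN := h.p_lt_N
  set K := SNormLESNormFDerivOfEqConst ℝ (volume : Measure (RN N)) p.toNNReal
  have hφ : ∀ φ : 𝓓(Ω, ℝ), eLpNorm φ (ENNReal.ofReal (pstar N p)) volume ≤
      K * ENNReal.ofReal ‖testEmbedding Ω p m φ‖ := by
    intro φ
    have h1 := eLpNorm_le_eLpNorm_fderiv_of_eq (volume : Measure (RN N)) (u := φ)
      (p := p.toNNReal) (p' := (pstar N p).toNNReal)
      (φ.contDiff.of_le (by simp)) φ.hasCompactSupport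
      (by rw [← Real.toNNReal_one]; exact Real.toNNReal_le_toNNReal (by linarith))
      (by rw [finrank_euclideanSpace_fin]; exact_mod_cast hN)
      (by
        rw [finrank_euclideanSpace_fin, NNReal.coe_inv, Real.coe_toNNReal _ (by linarith),
          Real.coe_toNNReal _ (by linarith), pstar]
        have : (N : ℝ) - p ≠ 0 := by linarith
        field_simp)
    refine h1.trans ?_
    gcongr
    have h2 : eLpNorm (fderiv ℝ φ) (p.toNNReal) volume
        = eLpNorm (gradient φ) (ENNReal.ofReal p) (volume : Measure (RN N)) := by
      refine eLpNorm_congr_norm_ae (Eventually.of_forall fun x => ?_)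
      simp [gradient]
    rw [h2]
    let v : X Ω p m := ⟨testEmbedding Ω p m φ, subset_closure ⟨φ, rfl⟩⟩
    have h3 : grad v =ᵐ[volume] gradient φ :=
      (memLp_gradient_testFunction (ENNReal.ofReal p) φ).coeFn_toLp
    rw [← eLpNorm_congr_ae h3]
    exact eLpNorm_grad_le v
  refine ⟨K + 1, by positivity, fun v => ?_⟩
  obtain ⟨φ, hlim, h0, -, -⟩ := exists_testFunction_approx v
  have h1 : eLpNorm (val v) (ENNReal.ofReal (pstar N p)) volume ≤
      liminf (fun k => eLpNorm (φ k) (ENNReal.ofReal (pstar N p)) (volume : Measure (RN N))) atTop :=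
    Lp.eLpNorm_lim_le_liminf_eLpNorm
      (fun k => ((φ k).continuous.aestronglyMeasurable)) _ h0
  have h2 : Tendsto (fun k => (K : ℝ≥0∞) * ENNReal.ofReal ‖testEmbedding Ω p m (φ k)‖) atTop
      (𝓝 (K * ENNReal.ofReal ‖v‖)) :=
    ENNReal.Tendsto.const_mul (ENNReal.tendsto_ofReal hlim.norm) (Or.inr ENNReal.coe_ne_top)
  calc eLpNorm (val v) (ENNReal.ofReal (pstar N p)) volume
      ≤ liminf (fun k => (K : ℝ≥0∞) * ENNReal.ofReal ‖testEmbedding Ω p m (φ k)‖) atTop :=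
        h1.trans (liminf_le_liminf (Eventually.of_forall fun k => hφ (φ k)))
    _ = K * ENNReal.ofReal ‖v‖ := h2.liminf_eq
    _ ≤ ENNReal.ofReal (K + 1) * ENNReal.ofReal ‖v‖ := by
        gcongr
        rw [← ENNReal.ofReal_coe_nnreal]
        exact ENNReal.ofReal_le_ofReal (by linarith)
    _ = _ := by rw [← ENNReal.ofReal_mul (by positivity)]

theorem integrable_and_integral_rpow_le {α E : Type*} [MeasurableSpace α] {μ : Measure α}
    [NormedAddCommGroup E] {f : α → E} {q r : ℝ} (hq : 0 < q) (hr : 0 ≤ r)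
    (hf : AEStronglyMeasurable f μ) (h : eLpNorm f (ENNReal.ofReal q) μ ≤ ENNReal.ofReal r) :
    Integrable (fun x => ‖f x‖ ^ q) μ ∧ ∫ x, ‖f x‖ ^ q ∂μ ≤ r ^ q := by
  have hm : MemLp f (ENNReal.ofReal q) μ := ⟨hf, h.trans_lt ENNReal.ofReal_lt_top⟩
  have hq0 : ENNReal.ofReal q ≠ 0 := by simpa using hq
  have hi := hm.integrable_norm_rpow hq0 ENNReal.ofReal_ne_top
  rw [hm.eLpNorm_eq_integral_rpow_norm hq0 ENNReal.ofReal_ne_top,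
    ENNReal.ofReal_le_ofReal_iff hr] at h
  rw [ENNReal.toReal_ofReal hq.le] at h hi
  refine ⟨hi, ?_⟩
  have h0 : 0 ≤ ∫ x, ‖f x‖ ^ q ∂μ := integral_nonneg fun x => by positivity
  rwa [Real.rpow_inv_le_iff_of_pos h0 hr hq] at h

/-- The modular `∫ (|v|^p + |v|^{p*} + |Dv|^p + |Dv|^m)`. -/
def rho (v : X Ω p m) : ℝ := ∫ x, psi N p m (val v x) (grad v x)

theorem rho_nonneg (v : X Ω p m) : 0 ≤ rho v := integral_nonneg fun _ => psi_nonneg _ _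

theorem exists_rho_le (h : Exponents N p m) :
    ∃ K : ℝ, 0 < K ∧ ∀ v : X Ω p m,
      Integrable (fun x => psi N p m (val v x) (grad v x)) ∧
      rho v ≤ ‖v‖ ^ p + (K * ‖v‖) ^ pstar N p + ‖v‖ ^ p + ‖v‖ ^ m := by
  have hm := h.two_le_m
  have hp := h.two_lt_p
  have hP := h.p_lt_pstar
  obtain ⟨K, hK, H⟩ := exists_eLpNorm_val_pstar_le (Ω := Ω) h
  refine ⟨K, hK, fun v => ?_⟩
  have h1 := integrable_and_integral_rpow_le (by linarith) (norm_nonneg v)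
    (aestronglyMeasurable_val v) (eLpNorm_val_le v)
  have h2 := integrable_and_integral_rpow_le (by linarith) (by positivity)
    (aestronglyMeasurable_val v) (H v)
  have h3 := integrable_and_integral_rpow_le (by linarith) (norm_nonneg v)
    (aestronglyMeasurable_grad v) (eLpNorm_grad_le v)
  have h4 := integrable_and_integral_rpow_le (by linarith) (norm_nonneg v)
    (aestronglyMeasurable_grad v) (eLpNorm_grad_le' v)
  simp only [Real.norm_eq_abs] at h1 h2
  refine ⟨((h1.1.add h2.1).add h3.1).add h4.1, ?_⟩
  have e : rho v = (∫ x, |val v x| ^ p) + (∫ x, |val v x| ^ pstar N p) +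
      (∫ x, ‖grad v x‖ ^ p) + ∫ x, ‖grad v x‖ ^ m := by
    have i1 := integral_add h1.1 h2.1
    have i2 := integral_add (h1.1.add h2.1) h3.1
    have i3 := integral_add ((h1.1.add h2.1).add h3.1) h4.1
    simp only [Pi.add_apply] at i1 i2 i3
    rw [← i1, ← i2, ← i3]
    rfl
  rw [e]
  linarith [h1.2, h2.2, h3.2, h4.2]

theorem integrable_psi (h : Exponents N p m) (v : X Ω p m) :
    Integrable (fun x => psi N p m (val v x) (grad v x)) := by
  obtain ⟨K, -, H⟩ := exists_rho_le (Ω := Ω) h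
  exact (H v).1

theorem exists_rho_le_of_norm_le (h : Exponents N p m) (R : ℝ) :
    ∃ K : ℝ, 0 < K ∧ ∀ v : X Ω p m, ‖v‖ ≤ R → rho v ≤ K := by
  have hm := h.two_le_m
  have hp := h.two_lt_p
  have hP := h.p_lt_pstar
  obtain ⟨K, hK, H⟩ := exists_rho_le (Ω := Ω) h
  refine ⟨|R| ^ p + (K * |R|) ^ pstar N p + |R| ^ p + |R| ^ m + 1, by positivity, fun v hv => ?_⟩
  have hv' := hv.trans (le_abs_self R)
  have hv0 := norm_nonneg v
  have e1 : ‖v‖ ^ p ≤ |R| ^ p := Real.rpow_le_rpow hv0 hv' (by linarith)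
  have e2 : ‖v‖ ^ m ≤ |R| ^ m := Real.rpow_le_rpow hv0 hv' (by linarith)
  have e3 : (K * ‖v‖) ^ pstar N p ≤ (K * |R|) ^ pstar N p :=
    Real.rpow_le_rpow (by positivity) (by gcongr) (by linarith)
  linarith [(H v).2]

theorem tendsto_rho_zero (h : Exponents N p m) :
    Tendsto (fun v : X Ω p m => rho v) (𝓝 0) (𝓝 0) := by
  have hm := h.two_le_m
  have hp := h.two_lt_p
  have hP := h.p_lt_pstar
  obtain ⟨K, hK, H⟩ := exists_rho_le (Ω := Ω) h
  have hc : Continuous (fun v : X Ω p m =>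
      ‖v‖ ^ p + (K * ‖v‖) ^ pstar N p + ‖v‖ ^ p + ‖v‖ ^ m) := by
    refine (((?_ : Continuous _).add ?_).add ?_).add ?_ <;>
    · refine Continuous.rpow_const (by fun_prop) fun _ => Or.inr (by linarith)
  have h0 := hc.tendsto 0
  rw [norm_zero, mul_zero, Real.zero_rpow (by linarith), Real.zero_rpow (by linarith),
    Real.zero_rpow (by linarith)] at h0
  simp only [add_zero] at h0
  exact squeeze_zero (fun v => rho_nonneg v) (fun v => (H v).2) h0

theorem exists_norm_le_of_weak_tendsto {E : Type*} [NormedAddCommGroup E] [NormedSpace ℝ E]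
    {u : ℕ → E} {u₀ : E}
    (hweak : ∀ f : StrongDual ℝ E, Tendsto (fun n => f (u n)) atTop (𝓝 (f u₀))) :
    ∃ R : ℝ, ∀ n, ‖u n‖ ≤ R := by
  obtain ⟨R, hR⟩ := banach_steinhaus (g := fun n => NormedSpace.inclusionInDoubleDual ℝ E (u n))
    (fun f => by
      obtain ⟨C, hC⟩ := (hweak f).norm.bddAbove_range
      exact ⟨C, fun n => hC ⟨n, rfl⟩⟩)
  refine ⟨R, fun n => ?_⟩
  rw [← (NormedSpace.inclusionInDoubleDualLi ℝ (E := E)).norm_map (u n)]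
  exact hR n

end Space

/-- Dominated convergence up to small multiples of a sequence bounded in `L¹`. -/
theorem tendsto_integral_zero_of_le_mul_add {α : Type*} [MeasurableSpace α] {μ : Measure α}
    {f A : ℕ → α → ℝ} {K : ℝ} (hf : ∀ n, AEStronglyMeasurable (f n) μ)
    (hf0 : ∀ n x, 0 ≤ f n x) (hlim : ∀ᵐ x ∂μ, Tendsto (fun n => f n x) atTop (𝓝 0))
    (hA0 : ∀ n x, 0 ≤ A n x) (hA : ∀ n, Integrable (A n) μ) (hAK : ∀ n, ∫ x, A n x ∂μ ≤ K)
    (hle : ∀ ε : ℝ, 0 < ε → ∃ H : α → ℝ, Integrable H μ ∧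
      ∀ n, ∀ᵐ x ∂μ, f n x ≤ ε * A n x + H x) :
    Tendsto (fun n => ∫ x, f n x ∂μ) atTop (𝓝 0) := by
  have hK : 0 < |K| + 1 := by positivity
  have key : ∀ ε > 0, ∀ᶠ n in atTop, ∫ x, f n x ∂μ < ε := by
    intro ε hε
    obtain ⟨H, hH, hfH⟩ := hle (ε / 2 / (|K| + 1)) (by positivity)
    have hHm : ∀ n, AEStronglyMeasurable (fun x => min (f n x) |H x|) μ := fun n =>
      (hf n).inf hH.abs.aestronglyMeasurable
    have hb : ∀ n x, ‖min (f n x) |H x|‖ ≤ |H x| := fun n x => by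
      rw [Real.norm_eq_abs, abs_of_nonneg (le_min (hf0 n x) (abs_nonneg _))]
      exact min_le_right _ _
    have ht : Tendsto (fun n => ∫ x, min (f n x) |H x| ∂μ) atTop (𝓝 0) := by
      have := tendsto_integral_of_dominated_convergence (f := fun _ => (0 : ℝ)) (fun x => |H x|)
        hHm hH.abs (fun n => Eventually.of_forall (hb n)) (by
          filter_upwards [hlim] with x hx
          have := hx.min (tendsto_const_nhds (x := |H x|))
          rwa [min_eq_left (abs_nonneg _)] at this)
      simpa using this
    filter_upwards [ht.eventually_lt_const (half_pos hε)] with n hn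
    have hmi : Integrable (fun x => min (f n x) |H x|) μ :=
      hH.abs.mono' (hHm n) (Eventually.of_forall (hb n))
    have h1 : ∫ x, f n x ∂μ ≤ ∫ x, (ε / 2 / (|K| + 1) * A n x + min (f n x) |H x|) ∂μ := by
      refine integral_mono_of_nonneg (Eventually.of_forall (hf0 n)) (((hA n).const_mul _).add hmi) ?_
      filter_upwards [hfH n] with x hx
      by_cases h : f n x ≤ |H x|
      · have h2 : 0 ≤ ε / 2 / (|K| + 1) * A n x := mul_nonneg (by positivity) (hA0 n x)
        rw [min_eq_left h]
        linarith
      · rw [min_eq_right (not_le.1 h).le]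
        linarith [le_abs_self (H x)]
    rw [integral_add ((hA n).const_mul _) hmi, integral_const_mul] at h1
    have h2 : ε / 2 / (|K| + 1) * ∫ x, A n x ∂μ ≤ ε / 2 := by
      calc _ ≤ ε / 2 / (|K| + 1) * (|K| + 1) := by
            gcongr; linarith [hAK n, le_abs_self K]
        _ = ε / 2 := by field_simp
    linarith
  refine tendsto_order.2 ⟨fun a ha => Eventually.of_forall fun n =>
    ha.trans_le (integral_nonneg (hf0 n)), key⟩

/-- Integrands whose derivative is controlled by the growth functions and splits up to a small
multiple of them. `JS` and `JX` are the partial derivatives. -/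
structure Admissible (N : ℕ) (p m : ℝ) (J JS : ℝ → RN N → ℝ) (JX : ℝ → RN N → RN N) : Prop where
  continuous : Continuous (fun z : ℝ × RN N => J z.1 z.2)
  continuous_S : Continuous (fun z : ℝ × RN N => JS z.1 z.2)
  continuous_X : Continuous (fun z : ℝ × RN N => JX z.1 z.2)
  hasDerivAt : ∀ (s t : ℝ) (a b : RN N) (τ : ℝ), HasDerivAt (fun r : ℝ => J (s + r * t) (a + r • b))
    (JS (s + τ * t) (a + τ • b) * t + inner ℝ (JX (s + τ * t) (a + τ • b)) b) τ
  bound : ∃ K : ℝ, 0 < K ∧ ∀ s a, |J s a| ≤ K * psi N p m s a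
  bound_deriv : ∃ K : ℝ, 0 < K ∧ ∀ s a, |JS s a| ≤ K * phiS N p s a ∧
    ‖JX s a‖ ≤ K * phiX N p m s a
  split : ∀ ε : ℝ, 0 < ε → ∃ C : ℝ, 0 < C ∧ ∀ (s t : ℝ) (a b : RN N),
    |JS (s + t) (a + b) - JS s a| ≤ ε * phiS N p s a + C * phiS N p t b ∧
    ‖JX (s + t) (a + b) - JX s a‖ ≤ ε * phiX N p m s a + C * phiX N p m t b

/-- Bounded measurable weights. -/
def BddWeight {N : ℕ} (W : RN N → ℝ) : Prop :=
  AEStronglyMeasurable W volume ∧ ∃ B : ℝ, 0 < B ∧ ∀ x, |W x| ≤ B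

section Generic

variable {N : ℕ} {p m : ℝ}

theorem phiS_mul_le (h : Exponents N p m) {τ : ℝ} (h0 : 0 ≤ τ) (h1 : τ ≤ 1) (s : ℝ) (a : RN N) :
    phiS N p (τ * s) (τ • a) ≤ phiS N p s a := by
  have e1 : |τ * s| ≤ |s| := by
    rw [abs_mul, abs_of_nonneg h0]; exact mul_le_of_le_one_left (abs_nonneg _) h1
  have e2 : ‖τ • a‖ ≤ ‖a‖ := by
    rw [norm_smul, Real.norm_eq_abs, abs_of_nonneg h0]
    exact mul_le_of_le_one_left (norm_nonneg _) h1
  have hp := h.two_lt_p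
  have hP := h.p_lt_pstar
  have hm := h.two_le_m
  have hb := h.m_lt
  unfold phiS
  gcongr <;> linarith

theorem phiX_mul_le (h : Exponents N p m) {τ : ℝ} (h0 : 0 ≤ τ) (h1 : τ ≤ 1) (s : ℝ) (a : RN N) :
    phiX N p m (τ * s) (τ • a) ≤ phiX N p m s a := by
  have e1 : |τ * s| ≤ |s| := by
    rw [abs_mul, abs_of_nonneg h0]; exact mul_le_of_le_one_left (abs_nonneg _) h1
  have e2 : ‖τ • a‖ ≤ ‖a‖ := by
    rw [norm_smul, Real.norm_eq_abs, abs_of_nonneg h0]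
    exact mul_le_of_le_one_left (norm_nonneg _) h1
  have hp := h.two_lt_p
  have hm := h.two_le_m
  unfold phiX
  gcongr <;> linarith

theorem phiS_neg (s : ℝ) (a : RN N) : phiS N p (-s) (-a) = phiS N p s a := by simp [phiS]

theorem phiX_neg (s : ℝ) (a : RN N) : phiX N p m (-s) (-a) = phiX N p m s a := by simp [phiX]

theorem phiS_zero (h : Exponents N p m) : phiS N p 0 0 = 0 := by
  have hp := h.two_lt_p
  have hP := h.p_lt_pstar
  have hm := h.two_le_m
  have hb := h.m_lt
  unfold phiS
  rw [abs_zero, norm_zero, Real.zero_rpow (by linarith), Real.zero_rpow (by linarith),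
    Real.zero_rpow (by linarith)]
  simp

theorem phiX_zero (h : Exponents N p m) : phiX N p m 0 0 = 0 := by
  have hp := h.two_lt_p
  have hm := h.two_le_m
  unfold phiX
  rw [abs_zero, norm_zero, Real.zero_rpow (by linarith), Real.zero_rpow (by linarith)]
  simp

namespace Admissible

variable {J JS : ℝ → RN N → ℝ} {JX : ℝ → RN N → RN N}

theorem zero_S (hJ : Admissible N p m J JS JX) (h : Exponents N p m) : JS 0 0 = 0 := by
  obtain ⟨K, -, H⟩ := hJ.bound_deriv
  have := (H 0 0).1
  rw [phiS_zero h, mul_zero] at this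
  exact abs_nonpos_iff.1 this

theorem zero_X (hJ : Admissible N p m J JS JX) (h : Exponents N p m) : JX 0 0 = 0 := by
  obtain ⟨K, -, H⟩ := hJ.bound_deriv
  have := (H 0 0).2
  rw [phiX_zero h, mul_zero] at this
  exact norm_le_zero_iff.1 this

/-- First order Taylor estimate. -/
theorem taylor (hJ : Admissible N p m J JS JX) (h : Exponents N p m) {ε : ℝ} (hε : 0 < ε) :
    ∃ C : ℝ, 0 < C ∧ ∀ (s t : ℝ) (a b : RN N),
      |J (s + t) (a + b) - J s a - (JS s a * t + inner ℝ (JX s a) b)| ≤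
        ε * (phiS N p s a * |t| + phiX N p m s a * ‖b‖) +
          C * (phiS N p t b * |t| + phiX N p m t b * ‖b‖) := by
  obtain ⟨C, hC, H⟩ := hJ.split ε hε
  refine ⟨C, hC, fun s t a b => ?_⟩
  set D := JS s a * t + inner ℝ (JX s a) b with hD
  have hd : ∀ τ ∈ Icc (0 : ℝ) 1, HasDerivWithinAt
      (fun r : ℝ => J (s + r * t) (a + r • b) - r * D)
      ((JS (s + τ * t) (a + τ • b) * t + inner ℝ (JX (s + τ * t) (a + τ • b)) b) - 1 * D)
      (Icc 0 1) τ := fun τ _ =>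
    ((hJ.hasDerivAt s t a b τ).sub ((hasDerivAt_id τ).mul_const D)).hasDerivWithinAt
  have hb : ∀ τ ∈ Ico (0 : ℝ) 1,
      ‖(JS (s + τ * t) (a + τ • b) * t + inner ℝ (JX (s + τ * t) (a + τ • b)) b) - 1 * D‖ ≤
        ε * (phiS N p s a * |t| + phiX N p m s a * ‖b‖) +
          C * (phiS N p t b * |t| + phiX N p m t b * ‖b‖) := by
    intro τ hτ
    obtain ⟨h1, h2⟩ := H s (τ * t) a (τ • b)
    have h3 := phiS_mul_le h hτ.1 hτ.2.le t b
    have h4 := phiX_mul_le h hτ.1 hτ.2.le t b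
    have h5 : |JS (s + τ * t) (a + τ • b) - JS s a| ≤
        ε * phiS N p s a + C * phiS N p t b := h1.trans (by gcongr)
    have h6 : ‖JX (s + τ * t) (a + τ • b) - JX s a‖ ≤
        ε * phiX N p m s a + C * phiX N p m t b := h2.trans (by gcongr)
    have e : (JS (s + τ * t) (a + τ • b) * t + inner ℝ (JX (s + τ * t) (a + τ • b)) b) - 1 * D =
        (JS (s + τ * t) (a + τ • b) - JS s a) * t +
          inner ℝ (JX (s + τ * t) (a + τ • b) - JX s a) b := by
      rw [hD, inner_sub_left]; ring
    rw [e]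
    calc _ ≤ |JS (s + τ * t) (a + τ • b) - JS s a| * |t| +
          ‖JX (s + τ * t) (a + τ • b) - JX s a‖ * ‖b‖ := by
          refine (norm_add_le _ _).trans (add_le_add ?_ (norm_inner_le_norm _ _))
          rw [Real.norm_eq_abs, abs_mul]
      _ ≤ (ε * phiS N p s a + C * phiS N p t b) * |t| +
          (ε * phiX N p m s a + C * phiX N p m t b) * ‖b‖ := by gcongr
      _ = _ := by ring
  have := norm_image_sub_le_of_norm_deriv_le_segment_01' hd hb
  simp only [one_mul, one_smul, zero_mul, zero_smul, add_zero, sub_zero] at this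
  rw [Real.norm_eq_abs] at this
  convert this using 2
  ring

end Admissible

variable {Ω : TopologicalSpace.Opens (RN N)}
  [Fact (1 ≤ ENNReal.ofReal p)] [Fact (1 ≤ ENNReal.ofReal m)]

theorem aestronglyMeasurable_comp {E : Type*} [TopologicalSpace E] {F : ℝ → RN N → E}
    (hF : Continuous (fun z : ℝ × RN N => F z.1 z.2)) (z : X Ω p m) :
    AEStronglyMeasurable (fun x => F (val z x) (grad z x)) volume :=
  hF.comp_aestronglyMeasurable ((aestronglyMeasurable_val z).prodMk (aestronglyMeasurable_grad z))

/-- The density bounding `|JS(z, Dz) v| + |JX(z, Dz) · Dv|`. -/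
def dens (z v : X Ω p m) (x : RN N) : ℝ :=
  phiS N p (val z x) (grad z x) * |val v x| + phiX N p m (val z x) (grad z x) * ‖grad v x‖

theorem dens_nonneg (z v : X Ω p m) (x : RN N) : 0 ≤ dens z v x := by
  have := phiS_nonneg (p := p) (val z x) (grad z x)
  have := phiX_nonneg (p := p) (m := m) (val z x) (grad z x)
  unfold dens; positivity

theorem aestronglyMeasurable_dens (h : Exponents N p m) (z v : X Ω p m) :
    AEStronglyMeasurable (dens z v) volume :=
  ((aestronglyMeasurable_comp h.continuous_phiS z).mul (aestronglyMeasurable_val v).norm).add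
    ((aestronglyMeasurable_comp h.continuous_phiX z).mul (aestronglyMeasurable_grad v).norm)

theorem integrable_dens (h : Exponents N p m) (z v : X Ω p m) : Integrable (dens z v) := by
  obtain ⟨C, hC, H⟩ := h.young one_pos
  refine (((integrable_psi h v).const_mul 1).add ((integrable_psi h z).const_mul C)).mono'
    (aestronglyMeasurable_dens h z v) (Eventually.of_forall fun x => ?_)
  rw [Real.norm_eq_abs, abs_of_nonneg (dens_nonneg z v x)]
  exact (H _ _ _ _).1

theorem dens_smul (z v : X Ω p m) (c : ℝ) : ∀ᵐ x, dens z (c • v) x = |c| * dens z v x := by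
  filter_upwards [val_smul c v, grad_smul c v] with x h1 h2
  rw [dens, dens, h1, h2, abs_mul, norm_smul, Real.norm_eq_abs]
  ring

theorem le_mul_norm_of_homogeneous {E : Type*} [NormedAddCommGroup E] [NormedSpace ℝ E]
    {q : E → ℝ} {K : ℝ} (hq : ∀ (c : ℝ) v, q (c • v) = |c| * q v) (hK : ∀ v, ‖v‖ ≤ 1 → q v ≤ K)
    (v : E) : q v ≤ K * ‖v‖ := by
  rcases eq_or_ne v 0 with rfl | hv
  · have := hq 0 0
    rw [smul_zero, abs_zero, zero_mul] at this
    simp [this]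
  · have hv' : 0 < ‖v‖ := norm_pos_iff.2 hv
    have h1 := hK (‖v‖⁻¹ • v) (by rw [norm_smul, norm_inv, norm_norm, inv_mul_cancel₀ hv'.ne'])
    rw [hq, abs_of_nonneg (by positivity), inv_mul_le_iff₀ hv'] at h1
    linarith

theorem integral_mul_dens_smul (θ : RN N → ℝ) (z v : X Ω p m) (c : ℝ) :
    ∫ x, θ x * dens z (c • v) x = |c| * ∫ x, θ x * dens z v x := by
  rw [← integral_const_mul]
  refine integral_congr_ae ?_
  filter_upwards [dens_smul z v c] with x hx
  rw [hx]; ring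

theorem integral_dens_smul (z v : X Ω p m) (c : ℝ) :
    ∫ x, dens z (c • v) x = |c| * ∫ x, dens z v x := by
  rw [← integral_const_mul]
  exact integral_congr_ae (dens_smul z v c)

theorem exists_integral_dens_le (h : Exponents N p m) (R : ℝ) :
    ∃ K : ℝ, 0 < K ∧ ∀ z : X Ω p m, ‖z‖ ≤ R → ∀ v : X Ω p m, ∫ x, dens z v x ≤ K * ‖v‖ := by
  obtain ⟨C, hC, H⟩ := h.young one_pos
  obtain ⟨K₁, hK₁, H₁⟩ := exists_rho_le_of_norm_le (Ω := Ω) h R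
  obtain ⟨K₂, hK₂, H₂⟩ := exists_rho_le_of_norm_le (Ω := Ω) h 1
  refine ⟨1 * K₂ + C * K₁, by positivity, fun z hz v => ?_⟩
  refine le_mul_norm_of_homogeneous (q := fun v => ∫ x, dens z v x)
    (fun c v => integral_dens_smul z v c) (fun v hv => ?_) v
  have : ∫ x, dens z v x ≤ 1 * rho v + C * rho z := by
    rw [rho, rho, ← integral_const_mul, ← integral_const_mul,
      ← integral_add ((integrable_psi h v).const_mul 1) ((integrable_psi h z).const_mul C)]
    exact integral_mono (integrable_dens h z v)
      (((integrable_psi h v).const_mul 1).add ((integrable_psi h z).const_mul C))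
      fun x => (H _ _ _ _).1
  have a1 := H₁ z hz
  have a2 := H₂ v hv
  nlinarith

/-- If the modular part `∫ θ_n psi(z_n, Dz_n)` tends to zero then `∫ θ_n dens(z_n, v)` tends to zero
uniformly for `v` in bounded sets. -/
theorem eventually_integral_mul_dens_le (h : Exponents N p m) {ι : Type*} {l : Filter ι}
    {θ : ι → RN N → ℝ} {z : ι → X Ω p m} (hθ : ∀ i, AEStronglyMeasurable (θ i) volume)
    (hθ0 : ∀ i x, 0 ≤ θ i x) (hθ1 : ∀ i x, θ i x ≤ 1)
    (hlim : Tendsto (fun i => ∫ x, θ i x * psi N p m (val (z i) x) (grad (z i) x)) l (𝓝 0))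
    {ε : ℝ} (hε : 0 < ε) :
    ∀ᶠ i in l, ∀ v : X Ω p m, ∫ x, θ i x * dens (z i) v x ≤ ε * ‖v‖ := by
  obtain ⟨K, hK, HK⟩ := exists_rho_le_of_norm_le (Ω := Ω) h 1
  obtain ⟨C, hC, H⟩ := h.young (show 0 < ε / 2 / K by positivity)
  filter_upwards [hlim.eventually_lt_const (show 0 < ε / 2 / C by positivity)] with i hi v
  refine le_mul_norm_of_homogeneous (q := fun v => ∫ x, θ i x * dens (z i) v x)
    (fun c v => integral_mul_dens_smul (θ i) (z i) v c) (fun v hv => ?_) v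
  have hi1 : Integrable (fun x => θ i x * psi N p m (val (z i) x) (grad (z i) x)) :=
    (integrable_psi h (z i)).bdd_mul (c := 1) (hθ i) (Eventually.of_forall fun x => by
      rw [Real.norm_eq_abs, abs_of_nonneg (hθ0 i x)]; exact hθ1 i x)
  have hi2 := ((integrable_psi h v).const_mul (ε / 2 / K)).add (hi1.const_mul C)
  have h1 : ∫ x, θ i x * dens (z i) v x ≤
      ∫ x, (ε / 2 / K * psi N p m (val v x) (grad v x) +
        C * (θ i x * psi N p m (val (z i) x) (grad (z i) x))) := by
    refine integral_mono_of_nonneg (Eventually.of_forall fun x =>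
      mul_nonneg (hθ0 i x) (dens_nonneg _ _ x)) hi2 (Eventually.of_forall fun x => ?_)
    have a1 := (H (val (z i) x) (val v x) (grad (z i) x) (grad v x)).1
    have a2 := hθ0 i x
    have a3 := hθ1 i x
    have a4 : 0 ≤ ε / 2 / K * psi N p m (val v x) (grad v x) :=
      mul_nonneg (by positivity) (psi_nonneg _ _)
    calc θ i x * dens (z i) v x ≤ θ i x * (ε / 2 / K * psi N p m (val v x) (grad v x) +
          C * psi N p m (val (z i) x) (grad (z i) x)) := by gcongr; exact a1
      _ ≤ _ := by nlinarith
  rw [integral_add ((integrable_psi h v).const_mul _) (hi1.const_mul C), integral_const_mul,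
    integral_const_mul] at h1
  have h2 : ε / 2 / K * ∫ x, psi N p m (val v x) (grad v x) ≤ ε / 2 / K * K := by
    gcongr; exact HK v hv
  have h3 : C * ∫ x, θ i x * psi N p m (val (z i) x) (grad (z i) x) ≤ C * (ε / 2 / C) := by
    gcongr
  have h4 : ε / 2 / K * K = ε / 2 := by field_simp
  have h5 : C * (ε / 2 / C) = ε / 2 := by field_simp
  linarith

theorem eventually_integral_dens_self_le (h : Exponents N p m) {ε : ℝ} (hε : 0 < ε) :
    ∀ᶠ z : X Ω p m in 𝓝 0, ∀ v : X Ω p m, ∫ x, dens z v x ≤ ε * ‖v‖ := by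
  have := eventually_integral_mul_dens_le (Ω := Ω) h (l := 𝓝 0) (θ := fun _ _ => 1) (z := id)
    (fun _ => aestronglyMeasurable_const) (fun _ _ => zero_le_one) (fun _ _ => le_rfl)
    (by simpa [rho] using tendsto_rho_zero (Ω := Ω) h) hε
  simpa using this

end Generic

theorem tendsto_dual_zero_of_eventually_le {E : Type*} [NormedAddCommGroup E] [NormedSpace ℝ E]
    {f : ℕ → StrongDual ℝ E} (h : ∀ ε : ℝ, 0 < ε → ∀ᶠ n in atTop, ∀ v, ‖f n v‖ ≤ ε * ‖v‖) :
    Tendsto f atTop (𝓝 0) := by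
  rw [tendsto_zero_iff_norm_tendsto_zero]
  refine tendsto_order.2 ⟨fun a ha => Eventually.of_forall fun n => ha.trans_le (norm_nonneg _),
    fun ε hε => ?_⟩
  filter_upwards [h (ε / 2) (half_pos hε)] with n hn
  exact lt_of_le_of_lt (ContinuousLinearMap.opNorm_le_bound _ (half_pos hε).le hn)
    (half_lt_self hε)

theorem integral_sub_sub {α : Type*} [MeasurableSpace α] {μ : Measure α} {f g k : α → ℝ}
    (hf : Integrable f μ) (hg : Integrable g μ) (hk : Integrable k μ) :
    (∫ x, f x ∂μ) - (∫ x, g x ∂μ) - ∫ x, k x ∂μ = ∫ x, (f x - g x - k x) ∂μ := by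
  have h1 := integral_sub (hf.sub hg) hk
  have h2 := integral_sub hf hg
  simp only [Pi.sub_apply] at h1
  rw [h1, h2]

theorem integral_sub_add {α : Type*} [MeasurableSpace α] {μ : Measure α} {f g k : α → ℝ}
    (hf : Integrable f μ) (hg : Integrable g μ) (hk : Integrable k μ) :
    (∫ x, f x ∂μ) - (∫ x, g x ∂μ) + ∫ x, k x ∂μ = ∫ x, (f x - g x + k x) ∂μ := by
  have h1 := integral_add (hf.sub hg) hk
  have h2 := integral_sub hf hg
  simp only [Pi.sub_apply] at h1
  rw [h1, h2]

namespace Admissible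

variable {N : ℕ} {p m : ℝ} {J JS : ℝ → RN N → ℝ} {JX : ℝ → RN N → RN N} {W : RN N → ℝ}
  {Ω : TopologicalSpace.Opens (RN N)}
  [Fact (1 ≤ ENNReal.ofReal p)] [Fact (1 ≤ ENNReal.ofReal m)]

/-- `JS(z, Dz) v + JX(z, Dz) · Dv`. -/
def _root_.QuasiLin.pairing (JS : ℝ → RN N → ℝ) (JX : ℝ → RN N → RN N) (z v : X Ω p m)
    (x : RN N) : ℝ :=
  JS (val z x) (grad z x) * val v x + inner ℝ (JX (val z x) (grad z x)) (grad v x)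

theorem integrable_energy (hJ : Admissible N p m J JS JX) (h : Exponents N p m)
    (hW : BddWeight W) (z : X Ω p m) :
    Integrable (fun x => W x * J (val z x) (grad z x)) := by
  obtain ⟨K, -, H⟩ := hJ.bound
  obtain ⟨B, -, hB⟩ := hW.2
  refine Integrable.bdd_mul (c := B) ?_ hW.1 (Eventually.of_forall hB)
  exact ((integrable_psi h z).const_mul K).mono' (aestronglyMeasurable_comp hJ.continuous z)
    (Eventually.of_forall fun x => H _ _)

theorem integrable_S (hJ : Admissible N p m J JS JX) (h : Exponents N p m)
    (hW : BddWeight W) (z v : X Ω p m) :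
    Integrable (fun x => W x * (JS (val z x) (grad z x) * val v x)) := by
  obtain ⟨K, hK, H⟩ := hJ.bound_deriv
  obtain ⟨B, -, hB⟩ := hW.2
  refine Integrable.bdd_mul (c := B) ?_ hW.1 (Eventually.of_forall hB)
  refine ((integrable_dens h z v).const_mul K).mono'
    ((aestronglyMeasurable_comp hJ.continuous_S z).mul (aestronglyMeasurable_val v))
    (Eventually.of_forall fun x => ?_)
  have h1 := mul_le_mul_of_nonneg_right (H (val z x) (grad z x)).1 (abs_nonneg (val v x))
  have h2 : 0 ≤ K * (phiX N p m (val z x) (grad z x) * ‖grad v x‖) :=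
    mul_nonneg hK.le (mul_nonneg (phiX_nonneg _ _) (norm_nonneg _))
  rw [Real.norm_eq_abs, abs_mul, dens]
  linarith

theorem integrable_X (hJ : Admissible N p m J JS JX) (h : Exponents N p m)
    (hW : BddWeight W) (z v : X Ω p m) :
    Integrable (fun x => W x * inner ℝ (JX (val z x) (grad z x)) (grad v x)) := by
  obtain ⟨K, hK, H⟩ := hJ.bound_deriv
  obtain ⟨B, -, hB⟩ := hW.2
  refine Integrable.bdd_mul (c := B) ?_ hW.1 (Eventually.of_forall hB)
  refine ((integrable_dens h z v).const_mul K).mono'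
    ((aestronglyMeasurable_comp hJ.continuous_X z).inner (aestronglyMeasurable_grad v))
    (Eventually.of_forall fun x => ?_)
  have h0 := norm_inner_le_norm (𝕜 := ℝ) (JX (val z x) (grad z x)) (grad v x)
  have h1 := mul_le_mul_of_nonneg_right (H (val z x) (grad z x)).2 (norm_nonneg (grad v x))
  have h2 : 0 ≤ K * (phiS N p (val z x) (grad z x) * |val v x|) :=
    mul_nonneg hK.le (mul_nonneg (phiS_nonneg _ _) (abs_nonneg _))
  rw [dens]
  linarith

theorem integrable_pairing (hJ : Admissible N p m J JS JX) (h : Exponents N p m)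
    (hW : BddWeight W) (z v : X Ω p m) :
    Integrable (fun x => W x * pairing JS JX z v x) := by
  refine ((hJ.integrable_S h hW z v).add (hJ.integrable_X h hW z v)).congr
    (Eventually.of_forall fun x => ?_)
  simp only [Pi.add_apply, pairing]; ring

theorem exists_integral_pairing_le (hJ : Admissible N p m J JS JX) (h : Exponents N p m)
    (hW : BddWeight W) (z : X Ω p m) :
    ∃ C : ℝ, ∀ v : X Ω p m, ‖∫ x, W x * pairing JS JX z v x‖ ≤ C * ‖v‖ := by
  obtain ⟨K, hK, H⟩ := hJ.bound_deriv
  obtain ⟨B, hB0, hB⟩ := hW.2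
  obtain ⟨C, hC, HC⟩ := exists_integral_dens_le (Ω := Ω) h ‖z‖
  refine ⟨B * K * C, fun v => ?_⟩
  calc ‖∫ x, W x * pairing JS JX z v x‖ ≤ ∫ x, B * K * dens z v x := by
        refine norm_integral_le_of_norm_le ((integrable_dens h z v).const_mul _)
          (Eventually.of_forall fun x => ?_)
        have h0 := norm_inner_le_norm (𝕜 := ℝ) (JX (val z x) (grad z x)) (grad v x)
        have h1 := mul_le_mul_of_nonneg_right (H (val z x) (grad z x)).1 (abs_nonneg (val v x))
        have h2 := mul_le_mul_of_nonneg_right (H (val z x) (grad z x)).2 (norm_nonneg (grad v x))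
        rw [norm_mul, mul_assoc]
        refine mul_le_mul (hB x) ?_ (norm_nonneg _) hB0.le
        refine (norm_add_le _ _).trans ?_
        rw [norm_mul, Real.norm_eq_abs, Real.norm_eq_abs (val v x), dens]
        linarith
    _ ≤ B * K * (C * ‖v‖) := by
        rw [integral_const_mul]; gcongr; exact HC z le_rfl v
    _ = _ := by ring

theorem integral_pairing_add (hJ : Admissible N p m J JS JX) (h : Exponents N p m)
    (hW : BddWeight W) (z v w : X Ω p m) :
    ∫ x, W x * pairing JS JX z (v + w) x =
      (∫ x, W x * pairing JS JX z v x) + ∫ x, W x * pairing JS JX z w x := by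
  rw [← integral_add (hJ.integrable_pairing h hW z v) (hJ.integrable_pairing h hW z w)]
  refine integral_congr_ae ?_
  filter_upwards [val_add v w, grad_add v w] with x h1 h2
  rw [pairing, pairing, pairing, h1, h2, inner_add_right]; ring

theorem _root_.QuasiLin.integral_pairing_smul (W : RN N → ℝ) (JS : ℝ → RN N → ℝ)
    (JX : ℝ → RN N → RN N) (z v : X Ω p m) (c : ℝ) :
    ∫ x, W x * pairing JS JX z (c • v) x = c * ∫ x, W x * pairing JS JX z v x := by
  rw [← integral_const_mul]
  refine integral_congr_ae ?_
  filter_upwards [val_smul c v, grad_smul c v] with x h1 h2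
  rw [pairing, pairing, h1, h2, inner_smul_right]; ring

/-- The linear form `v ↦ ∫ W (JS(z, Dz) v + JX(z, Dz) · Dv)`. -/
def form (hJ : Admissible N p m J JS JX) (h : Exponents N p m) (hW : BddWeight W)
    (z : X Ω p m) : StrongDual ℝ (X Ω p m) :=
  LinearMap.mkContinuousOfExistsBound
    (E := X Ω p m) (F := ℝ) (σ := RingHom.id ℝ)
    { toFun := fun v => ∫ x, W x * pairing JS JX z v x
      map_add' := hJ.integral_pairing_add h hW z
      map_smul' := fun c v => integral_pairing_smul W JS JX z v c }
    (hJ.exists_integral_pairing_le h hW z)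

theorem form_apply (hJ : Admissible N p m J JS JX) (h : Exponents N p m) (hW : BddWeight W)
    (z v : X Ω p m) : hJ.form h hW z v = ∫ x, W x * pairing JS JX z v x := rfl

theorem form_apply_eq_add (hJ : Admissible N p m J JS JX) (h : Exponents N p m) (hW : BddWeight W)
    (z v : X Ω p m) : hJ.form h hW z v = (∫ x, W x * (JS (val z x) (grad z x) * val v x)) +
      ∫ x, W x * inner ℝ (JX (val z x) (grad z x)) (grad v x) := by
  rw [form_apply, ← integral_add (hJ.integrable_S h hW z v) (hJ.integrable_X h hW z v)]
  simp only [pairing, mul_add]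

set_option maxHeartbeats 1000000 in
/-- The weighted energy is Fréchet differentiable. -/
theorem hasFDerivAt_energy (hJ : Admissible N p m J JS JX) (h : Exponents N p m)
    (hW : BddWeight W) (z : X Ω p m) :
    HasFDerivAt (fun v : X Ω p m => ∫ x, W x * J (val v x) (grad v x)) (hJ.form h hW z) z := by
  rw [hasFDerivAt_iff_isLittleO_nhds_zero, Asymptotics.isLittleO_iff]
  intro c hc
  obtain ⟨B, hB0, hB⟩ := hW.2
  obtain ⟨K, hK, HK⟩ := exists_integral_dens_le (Ω := Ω) h ‖z‖
  obtain ⟨C, hC, HC⟩ := hJ.taylor h (show 0 < c / 2 / B / K by positivity)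
  filter_upwards [eventually_integral_dens_self_le (Ω := Ω) h
    (show 0 < c / 2 / B / C by positivity)] with v hv
  have i1 := ((integrable_dens h z v).const_mul (c / 2 / B / K))
  have i2 := ((integrable_dens h v v).const_mul C)
  rw [form_apply, integral_sub_sub (hJ.integrable_energy h hW (z + v))
    (hJ.integrable_energy h hW z) (hJ.integrable_pairing h hW z v)]
  refine (norm_integral_le_of_norm_le ((i1.add i2).const_mul B) ?_).trans ?_
  · filter_upwards [val_add z v, grad_add z v] with x h1 h2
    rw [h1, h2, ← mul_sub, ← mul_sub, norm_mul]
    exact mul_le_mul (hB x) (HC _ _ _ _) (norm_nonneg _) hB0.le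
  · rw [integral_const_mul]
    have e := integral_add i1 i2
    simp only [integral_const_mul] at e
    simp only [Pi.add_apply]
    rw [e]
    calc B * (c / 2 / B / K * (∫ x, dens z v x) + C * ∫ x, dens v v x)
        ≤ B * (c / 2 / B / K * (K * ‖v‖) + C * (c / 2 / B / C * ‖v‖)) := by
          gcongr
          · exact HK z le_rfl v
          · exact hv v
      _ = c * ‖v‖ := by field_simp; ring

/-- Weak continuity of the derivative along bounded, almost everywhere convergent sequences. -/
theorem tendsto_form_apply (hJ : Admissible N p m J JS JX) (h : Exponents N p m)
    (hW : BddWeight W) {u : ℕ → X Ω p m} {u₀ : X Ω p m} {R : ℝ} (hR : ∀ n, ‖u n‖ ≤ R)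
    (hv : ∀ᵐ x, Tendsto (fun n => val (u n) x) atTop (𝓝 (val u₀ x)))
    (hg : ∀ᵐ x, Tendsto (fun n => grad (u n) x) atTop (𝓝 (grad u₀ x))) (v : X Ω p m) :
    Tendsto (fun n => hJ.form h hW (u n) v) atTop (𝓝 (hJ.form h hW u₀ v)) := by
  obtain ⟨B, hB0, hB⟩ := hW.2
  obtain ⟨K, hK, HK⟩ := hJ.bound_deriv
  obtain ⟨K₁, hK₁, HK₁⟩ := exists_rho_le_of_norm_le (Ω := Ω) h R
  rw [tendsto_iff_norm_sub_tendsto_zero]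
  have i : ∀ n, Integrable (fun x => W x * pairing JS JX (u n) v x - W x * pairing JS JX u₀ v x) :=
    fun n => (hJ.integrable_pairing h hW (u n) v).sub (hJ.integrable_pairing h hW u₀ v)
  have key : Tendsto (fun n => ∫ x, ‖W x * pairing JS JX (u n) v x - W x * pairing JS JX u₀ v x‖)
      atTop (𝓝 0) := by
    refine tendsto_integral_zero_of_le_mul_add (K := K₁)
      (A := fun n x => psi N p m (val (u n) x) (grad (u n) x))
      (fun n => (i n).aestronglyMeasurable.norm) (fun n x => norm_nonneg _) ?_
      (fun n x => psi_nonneg _ _) (fun n => integrable_psi h (u n)) (fun n => HK₁ _ (hR n)) ?_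
    · filter_upwards [hv, hg] with x h1 h2
      have hz := h1.prodMk_nhds h2
      have c1 := (hJ.continuous_S.tendsto _).comp hz
      have c2 := (hJ.continuous_X.tendsto _).comp hz
      have := ((c1.mul_const (val v x)).add
        (c2.inner (tendsto_const_nhds (x := grad v x)))).const_mul (W x)
      rw [← tendsto_iff_norm_sub_tendsto_zero]
      exact this
    · intro ε hε
      obtain ⟨C, hC, HC⟩ := h.young (show 0 < ε / (B * K) by positivity)
      refine ⟨fun x => B * K * (C * psi N p m (val v x) (grad v x)) + B * K * dens u₀ v x,
        (((integrable_psi h v).const_mul C).const_mul _).add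
          ((integrable_dens h u₀ v).const_mul _), fun n => Eventually.of_forall fun x => ?_⟩
      have pw : ∀ z : X Ω p m, ‖W x * pairing JS JX z v x‖ ≤ B * K * dens z v x := by
        intro z
        have h0 := norm_inner_le_norm (𝕜 := ℝ) (JX (val z x) (grad z x)) (grad v x)
        have h1 := mul_le_mul_of_nonneg_right (HK (val z x) (grad z x)).1 (abs_nonneg (val v x))
        have h2 := mul_le_mul_of_nonneg_right (HK (val z x) (grad z x)).2 (norm_nonneg (grad v x))
        rw [norm_mul, mul_assoc]
        refine mul_le_mul (hB x) ?_ (norm_nonneg _) hB0.le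
        refine (norm_add_le _ _).trans ?_
        rw [norm_mul, Real.norm_eq_abs, Real.norm_eq_abs (val v x), dens]
        linarith
      have h3 : dens (u n) v x ≤ ε / (B * K) * psi N p m (val (u n) x) (grad (u n) x) +
        C * psi N p m (val v x) (grad v x) := (HC _ _ _ _).2
      calc _ ≤ B * K * dens (u n) v x + B * K * dens u₀ v x :=
            (norm_sub_le _ _).trans (add_le_add (pw _) (pw _))
        _ ≤ B * K * (ε / (B * K) * psi N p m (val (u n) x) (grad (u n) x) +
              C * psi N p m (val v x) (grad v x)) + B * K * dens u₀ v x := by gcongr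
        _ = _ := by field_simp; ring
  refine squeeze_zero (fun n => norm_nonneg _) (fun n => ?_) key
  rw [form_apply, form_apply, ← integral_sub (hJ.integrable_pairing h hW (u n) v)
    (hJ.integrable_pairing h hW u₀ v)]
  exact norm_integral_le_integral_norm _

theorem _root_.QuasiLin.le_add_min_div_mul {f A D : ℝ} (hA : 0 ≤ A) (hD : 0 ≤ D) (h : f ≤ A + D) :
    f ≤ A + min 1 (f / D) * D := by
  rcases hD.eq_or_lt with rfl | hD
  · simpa using h
  · rcases le_total 1 (f / D) with h1 | h1
    · rw [min_eq_left h1]; linarith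
    · rw [min_eq_right h1, div_mul_cancel₀ _ hD.ne']; linarith

set_option maxHeartbeats 1000000 in
/-- Splitting of the derivative, in the dual norm. -/
theorem tendsto_form_split (hJ : Admissible N p m J JS JX) (h : Exponents N p m)
    (hW : BddWeight W) {u : ℕ → X Ω p m} {u₀ : X Ω p m} {R : ℝ} (hR : ∀ n, ‖u n‖ ≤ R)
    (hv : ∀ᵐ x, Tendsto (fun n => val (u n) x) atTop (𝓝 (val u₀ x)))
    (hg : ∀ᵐ x, Tendsto (fun n => grad (u n) x) atTop (𝓝 (grad u₀ x))) :
    Tendsto (fun n => hJ.form h hW (u n - u₀) - hJ.form h hW (u n) + hJ.form h hW u₀) atTop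
      (𝓝 0) := by
  obtain ⟨B, hB0, hB⟩ := hW.2
  obtain ⟨K, hK, HK⟩ := hJ.bound_deriv
  obtain ⟨K₁, hK₁, HK₁⟩ := exists_integral_dens_le (Ω := Ω) h R
  refine tendsto_dual_zero_of_eventually_le fun ε hε => ?_
  obtain ⟨C, hC, HC⟩ := hJ.split (ε / 2 / B / K₁) (by positivity)
  let s : ℕ → RN N → ℝ := fun n x => val (u n) x - val u₀ x
  let a : ℕ → RN N → RN N := fun n x => grad (u n) x - grad u₀ x
  let fS : ℕ → RN N → ℝ := fun n x =>
    |JS (s n x) (a n x) - JS (val (u n) x) (grad (u n) x) + JS (val u₀ x) (grad u₀ x)|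
  let fX : ℕ → RN N → ℝ := fun n x =>
    ‖JX (s n x) (a n x) - JX (val (u n) x) (grad (u n) x) + JX (val u₀ x) (grad u₀ x)‖
  let D := C + K
  have hD : 0 < D := by positivity
  let θ : ℕ → RN N → ℝ := fun n x =>
    max (min 1 (fS n x / (D * phiS N p (val u₀ x) (grad u₀ x))))
      (min 1 (fX n x / (D * phiX N p m (val u₀ x) (grad u₀ x))))
  have ms : ∀ n, AEStronglyMeasurable (s n) volume := fun n =>
    (aestronglyMeasurable_val (u n)).sub (aestronglyMeasurable_val u₀)
  have ma : ∀ n, AEStronglyMeasurable (a n) volume := fun n =>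
    (aestronglyMeasurable_grad (u n)).sub (aestronglyMeasurable_grad u₀)
  have mS : ∀ n, AEStronglyMeasurable (fS n) volume := fun n =>
    (((hJ.continuous_S.comp_aestronglyMeasurable ((ms n).prodMk (ma n))).sub
      (aestronglyMeasurable_comp hJ.continuous_S (u n))).add
      (aestronglyMeasurable_comp hJ.continuous_S u₀)).norm
  have mX : ∀ n, AEStronglyMeasurable (fX n) volume := fun n =>
    (((hJ.continuous_X.comp_aestronglyMeasurable ((ms n).prodMk (ma n))).sub
      (aestronglyMeasurable_comp hJ.continuous_X (u n))).add
      (aestronglyMeasurable_comp hJ.continuous_X u₀)).norm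
  have mθ : ∀ n, AEStronglyMeasurable (θ n) volume := by
    intro n
    have e1 := ((mS n).aemeasurable.div
      ((aestronglyMeasurable_comp h.continuous_phiS u₀).const_mul D).aemeasurable).aestronglyMeasurable
    have e2 := ((mX n).aemeasurable.div
      ((aestronglyMeasurable_comp h.continuous_phiX u₀).const_mul D).aemeasurable).aestronglyMeasurable
    exact (aestronglyMeasurable_const.inf e1).sup (aestronglyMeasurable_const.inf e2)
  have θ0 : ∀ n x, 0 ≤ θ n x := fun n x =>
    le_max_of_le_left (le_min zero_le_one
      (div_nonneg (abs_nonneg _) (mul_nonneg hD.le (phiS_nonneg _ _))))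
  have θ1 : ∀ n x, θ n x ≤ 1 := fun n x => max_le (min_le_left _ _) (min_le_left _ _)
  have θlim : ∀ᵐ x, Tendsto (fun n => θ n x) atTop (𝓝 0) := by
    filter_upwards [hv, hg] with x h1 h2
    have hz := h1.prodMk_nhds h2
    have hd : Tendsto (fun n => (s n x, a n x)) atTop (𝓝 (0, 0)) := by
      have d1 := h1.sub_const (val u₀ x)
      have d2 := h2.sub_const (grad u₀ x)
      rw [sub_self] at d1 d2
      exact d1.prodMk_nhds d2
    have c1 := ((((hJ.continuous_S.tendsto _).comp hd).sub
      ((hJ.continuous_S.tendsto _).comp hz)).add_const (JS (val u₀ x) (grad u₀ x))).abs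
    have c2 := ((((hJ.continuous_X.tendsto _).comp hd).sub
      ((hJ.continuous_X.tendsto _).comp hz)).add_const (JX (val u₀ x) (grad u₀ x))).norm
    simp only [hJ.zero_S h, hJ.zero_X h, zero_sub, neg_add_cancel, abs_zero, norm_zero] at c1 c2
    have c3 := ((tendsto_const_nhds (x := (1 : ℝ))).min
      (c1.div_const (D * phiS N p (val u₀ x) (grad u₀ x)))).max
      ((tendsto_const_nhds (x := (1 : ℝ))).min
      (c2.div_const (D * phiX N p m (val u₀ x) (grad u₀ x))))
    simp only [zero_div, min_eq_right zero_le_one, max_self] at c3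
    exact c3
  have lim : Tendsto (fun n => ∫ x, θ n x * psi N p m (val u₀ x) (grad u₀ x)) atTop (𝓝 0) := by
    have := tendsto_integral_of_dominated_convergence (f := fun _ => (0 : ℝ))
      (F := fun n x => θ n x * psi N p m (val u₀ x) (grad u₀ x))
      (fun x => psi N p m (val u₀ x) (grad u₀ x))
      (fun n => (mθ n).mul (aestronglyMeasurable_comp h.continuous_psi u₀)) (integrable_psi h u₀)
      (fun n => Eventually.of_forall fun x => by
        rw [norm_mul, Real.norm_eq_abs, Real.norm_eq_abs, abs_of_nonneg (θ0 n x),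
          abs_of_nonneg (psi_nonneg _ _)]
        exact mul_le_of_le_one_left (psi_nonneg _ _) (θ1 n x))
      (by
        filter_upwards [θlim] with x hx
        simpa using hx.mul_const (psi N p m (val u₀ x) (grad u₀ x)))
    simpa using this
  filter_upwards [eventually_integral_mul_dens_le h (z := fun _ => u₀) mθ θ0 θ1 lim
    (show 0 < ε / 2 / B / D by positivity)] with n hn v
  have i1 := (integrable_dens h (u n) v).const_mul (ε / 2 / B / K₁)
  have i2' : Integrable (fun x => θ n x * dens u₀ v x) :=
    (integrable_dens h u₀ v).bdd_mul (c := 1) (mθ n) (Eventually.of_forall fun x => by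
      rw [Real.norm_eq_abs, abs_of_nonneg (θ0 n x)]; exact θ1 n x)
  have i2 := i2'.const_mul D
  rw [add_apply, sub_apply, form_apply, form_apply,
    form_apply, integral_sub_add (hJ.integrable_pairing h hW _ v)
      (hJ.integrable_pairing h hW _ v) (hJ.integrable_pairing h hW _ v)]
  refine (norm_integral_le_of_norm_le ((i1.add i2).const_mul B) ?_).trans ?_
  · filter_upwards [val_sub (u n) u₀, grad_sub (u n) u₀] with x h1 h2
    obtain ⟨b1, b2⟩ := HC (val (u n) x) (-val u₀ x) (grad (u n) x) (-grad u₀ x)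
    obtain ⟨k1, k2⟩ := HK (val u₀ x) (grad u₀ x)
    rw [phiS_neg, ← sub_eq_add_neg, ← sub_eq_add_neg] at b1
    rw [phiX_neg, ← sub_eq_add_neg, ← sub_eq_add_neg] at b2
    have p1 := phiS_nonneg (p := p) (val u₀ x) (grad u₀ x)
    have p2 := phiX_nonneg (p := p) (m := m) (val u₀ x) (grad u₀ x)
    have q1 := phiS_nonneg (p := p) (val (u n) x) (grad (u n) x)
    have q2 := phiX_nonneg (p := p) (m := m) (val (u n) x) (grad (u n) x)
    have hε' : 0 < ε / 2 / B / K₁ := by positivity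
    have r1 : fS n x ≤ ε / 2 / B / K₁ * phiS N p (val (u n) x) (grad (u n) x) +
        D * phiS N p (val u₀ x) (grad u₀ x) := by
      have := abs_add_le (JS (s n x) (a n x) - JS (val (u n) x) (grad (u n) x))
        (JS (val u₀ x) (grad u₀ x))
      linarith
    have r2 : fX n x ≤ ε / 2 / B / K₁ * phiX N p m (val (u n) x) (grad (u n) x) +
        D * phiX N p m (val u₀ x) (grad u₀ x) := by
      have := norm_add_le (JX (s n x) (a n x) - JX (val (u n) x) (grad (u n) x))
        (JX (val u₀ x) (grad u₀ x))
      linarith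
    have r3 : fS n x ≤ ε / 2 / B / K₁ * phiS N p (val (u n) x) (grad (u n) x) +
        θ n x * (D * phiS N p (val u₀ x) (grad u₀ x)) :=
      (le_add_min_div_mul (mul_nonneg hε'.le q1) (mul_nonneg hD.le p1) r1).trans
        (by gcongr; exact le_max_left _ _)
    have r4 : fX n x ≤ ε / 2 / B / K₁ * phiX N p m (val (u n) x) (grad (u n) x) +
        θ n x * (D * phiX N p m (val u₀ x) (grad u₀ x)) :=
      (le_add_min_div_mul (mul_nonneg hε'.le q2) (mul_nonneg hD.le p2) r2).trans
        (by gcongr; exact le_max_right _ _)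
    have e : W x * pairing JS JX (u n - u₀) v x - W x * pairing JS JX (u n) v x +
        W x * pairing JS JX u₀ v x = W x *
        ((JS (s n x) (a n x) - JS (val (u n) x) (grad (u n) x) + JS (val u₀ x) (grad u₀ x)) *
          val v x + inner ℝ (JX (s n x) (a n x) - JX (val (u n) x) (grad (u n) x) +
            JX (val u₀ x) (grad u₀ x)) (grad v x)) := by
      simp only [pairing, h1, h2, inner_add_left, inner_sub_left, s, a]
      ring
    rw [e, norm_mul]
    refine mul_le_mul (hB x) ?_ (norm_nonneg _) hB0.le
    calc _ ≤ fS n x * |val v x| + fX n x * ‖grad v x‖ := by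
          refine (norm_add_le _ _).trans (add_le_add ?_ (norm_inner_le_norm _ _))
          rw [norm_mul]; rfl
      _ ≤ (ε / 2 / B / K₁ * phiS N p (val (u n) x) (grad (u n) x) +
            θ n x * (D * phiS N p (val u₀ x) (grad u₀ x))) * |val v x| +
          (ε / 2 / B / K₁ * phiX N p m (val (u n) x) (grad (u n) x) +
            θ n x * (D * phiX N p m (val u₀ x) (grad u₀ x))) * ‖grad v x‖ := by gcongr
      _ = _ := by simp only [dens, Pi.add_apply]; ring
  · rw [integral_const_mul]
    have e := integral_add i1 i2
    rw [integral_const_mul, integral_const_mul] at e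
    simp only [Pi.add_apply]
    rw [e]
    calc _ ≤ B * (ε / 2 / B / K₁ * (K₁ * ‖v‖) + D * (ε / 2 / B / D * ‖v‖)) := by
          gcongr
          · exact HK₁ _ (hR n) v
          · exact hn v
      _ = ε * ‖v‖ := by field_simp; ring

end Admissible

/-! ### Decaying weights -/

section Decay

variable {N : ℕ} {p m : ℝ} {W : RN N → ℝ} {Ω : TopologicalSpace.Opens (RN N)}
  [Fact (1 ≤ ENNReal.ofReal p)] [Fact (1 ≤ ENNReal.ofReal m)]

theorem rpow_sub_one_mul_le_dens (z v : X Ω p m) (x : RN N) :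
    |val z x| ^ (p - 1) * |val v x| ≤ dens z v x := by
  unfold dens phiS phiX
  have : 0 ≤ (|val z x| ^ (pstar N p - 1) + ‖grad z x‖ ^ (p - 1) +
      ‖grad z x‖ ^ (p - 1 + p / N)) * |val v x| := by positivity
  have : 0 ≤ (|val z x| ^ (p - 1) + ‖grad z x‖ ^ (p - 1) + ‖grad z x‖ ^ (m - 1)) *
    ‖grad v x‖ := by positivity
  nlinarith

/-- Local convergence in `L^p`: the sequence is bounded in a better space. -/
theorem tendsto_integral_indicator_rpow (h : Exponents N p m) {z : ℕ → X Ω p m} {R : ℝ}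
    (hR : ∀ n, ‖z n‖ ≤ R) (hz : ∀ᵐ x, Tendsto (fun n => val (z n) x) atTop (𝓝 0)) (r : ℝ) :
    Tendsto (fun n => ∫ x, (Metric.closedBall (0 : RN N) r).indicator
      (fun x => |val (z n) x| ^ p) x) atTop (𝓝 0) := by
  have hp := h.two_lt_p
  have hP := h.p_lt_pstar
  obtain ⟨K, hK, HK⟩ := exists_rho_le_of_norm_le (Ω := Ω) h R
  have hc : Continuous (fun s : ℝ => |s| ^ p) :=
    Continuous.rpow_const (by fun_prop) fun _ => Or.inr (by linarith)
  refine tendsto_integral_zero_of_le_mul_add (K := K)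
    (A := fun n x => psi N p m (val (z n) x) (grad (z n) x))
    (fun n => (hc.comp_aestronglyMeasurable (aestronglyMeasurable_val (z n))).indicator
      measurableSet_closedBall)
    (fun n x => indicator_nonneg (fun _ _ => by positivity) _) ?_
    (fun n x => psi_nonneg _ _) (fun n => integrable_psi h (z n)) (fun n => HK _ (hR n)) ?_
  · filter_upwards [hz] with x hx
    by_cases hxr : x ∈ Metric.closedBall (0 : RN N) r
    · simp only [indicator_of_mem hxr]
      have := (hc.tendsto 0).comp hx
      rw [abs_zero, Real.zero_rpow (by linarith)] at this
      exact this
    · simp only [indicator_of_notMem hxr]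
      exact tendsto_const_nhds
  · intro ε hε
    obtain ⟨C, hC, HC⟩ := exists_rpow_le_mul_rpow_add (show 0 < p by linarith) hP hε
    refine ⟨(Metric.closedBall (0 : RN N) r).indicator fun _ => C, ?_, fun n =>
      Eventually.of_forall fun x => ?_⟩
    · rw [integrable_indicator_iff measurableSet_closedBall]
      exact integrableOn_const measure_closedBall_lt_top.ne
    · have h1 : 0 ≤ ε * psi N p m (val (z n) x) (grad (z n) x) :=
        mul_nonneg hε.le (psi_nonneg _ _)
      by_cases hxr : x ∈ Metric.closedBall (0 : RN N) r
      · simp only [indicator_of_mem hxr]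
        refine (HC _ (abs_nonneg _)).trans ?_
        have : |val (z n) x| ^ pstar N p ≤ psi N p m (val (z n) x) (grad (z n) x) := by
          unfold psi
          have : 0 ≤ |val (z n) x| ^ p + ‖grad (z n) x‖ ^ p + ‖grad (z n) x‖ ^ m := by positivity
          linarith
        gcongr
      · simp only [indicator_of_notMem hxr]
        linarith

theorem integrable_mul_rpow_sub_one_mul (h : Exponents N p m) (hW : BddWeight W) (z v : X Ω p m) :
    Integrable (fun x => |W x| * (|val z x| ^ (p - 1) * |val v x|)) := by
  obtain ⟨B, hB0, hB⟩ := hW.2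
  have hc : Continuous (fun s : ℝ => |s| ^ (p - 1)) :=
    Continuous.rpow_const (by fun_prop) fun _ => Or.inr (by linarith [h.two_lt_p])
  refine Integrable.bdd_mul (c := B) ?_ hW.1.norm (Eventually.of_forall fun x => by
    rw [Real.norm_eq_abs, abs_abs]; exact hB x)
  refine (integrable_dens h z v).mono' ((hc.comp_aestronglyMeasurable
    (aestronglyMeasurable_val z)).mul (aestronglyMeasurable_val v).norm)
    (Eventually.of_forall fun x => ?_)
  rw [Real.norm_eq_abs, abs_of_nonneg (by positivity)]
  exact rpow_sub_one_mul_le_dens z v x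

/-- A weight vanishing at infinity is negligible along sequences converging to zero almost
everywhere. -/
theorem eventually_integral_decaying_le (h : Exponents N p m) (hW : BddWeight W)
    (hdecay : ∀ ε : ℝ, 0 < ε → ∃ r : ℝ, ∀ x, r < ‖x‖ → |W x| ≤ ε) {z : ℕ → X Ω p m} {R : ℝ}
    (hR : ∀ n, ‖z n‖ ≤ R) (hz : ∀ᵐ x, Tendsto (fun n => val (z n) x) atTop (𝓝 0))
    {ε : ℝ} (hε : 0 < ε) :
    ∀ᶠ n in atTop, ∀ v : X Ω p m,
      ∫ x, |W x| * (|val (z n) x| ^ (p - 1) * |val v x|) ≤ ε * ‖v‖ := by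
  have hp := h.two_lt_p
  obtain ⟨B, hB0, hB⟩ := hW.2
  obtain ⟨K₁, hK₁, HK₁⟩ := exists_integral_dens_le (Ω := Ω) h R
  obtain ⟨K₂, hK₂, HK₂⟩ := exists_rho_le_of_norm_le (Ω := Ω) h 1
  obtain ⟨r, hr⟩ := hdecay (ε / 2 / K₁) (by positivity)
  obtain ⟨C, hC, HC⟩ := exists_rpow_sub_one_mul_le (q := p) (by linarith)
    (show 0 < ε / 4 / B / K₂ by positivity)
  filter_upwards [(tendsto_integral_indicator_rpow h hR hz r).eventually_lt_const
    (show 0 < ε / 4 / B / C by positivity)] with n hn v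
  refine le_mul_norm_of_homogeneous
    (q := fun v => ∫ x, |W x| * (|val (z n) x| ^ (p - 1) * |val v x|)) (fun c v => ?_)
    (fun v hv => ?_) v
  · rw [← integral_const_mul]
    refine integral_congr_ae ?_
    filter_upwards [val_smul c v] with x hx
    rw [hx, abs_mul]; ring
  have hi : Integrable ((Metric.closedBall (0 : RN N) r).indicator
      (fun x => |val (z n) x| ^ p)) := by
    have hc : Continuous (fun s : ℝ => |s| ^ p) :=
      Continuous.rpow_const (by fun_prop) fun _ => Or.inr (by linarith)
    refine (integrable_psi h (z n)).mono' ((hc.comp_aestronglyMeasurable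
      (aestronglyMeasurable_val (z n))).indicator measurableSet_closedBall)
      (Eventually.of_forall fun x => ?_)
    refine (norm_indicator_le_norm_self _ _).trans ?_
    rw [Real.norm_eq_abs, abs_of_nonneg (by positivity)]
    unfold psi
    have : 0 ≤ |val (z n) x| ^ pstar N p + ‖grad (z n) x‖ ^ p + ‖grad (z n) x‖ ^ m := by positivity
    linarith
  have i1 := (integrable_dens h (z n) v).const_mul (ε / 2 / K₁)
  have i2 := (integrable_psi h v).const_mul (B * (ε / 4 / B / K₂))
  have i3 := hi.const_mul (B * C)
  have key : ∫ x, |W x| * (|val (z n) x| ^ (p - 1) * |val v x|) ≤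
      ∫ x, (ε / 2 / K₁ * dens (z n) v x + B * (ε / 4 / B / K₂) * psi N p m (val v x) (grad v x) +
        B * C * (Metric.closedBall (0 : RN N) r).indicator (fun x => |val (z n) x| ^ p) x) := by
    refine integral_mono (integrable_mul_rpow_sub_one_mul h hW (z n) v) ((i1.add i2).add i3)
      fun x => ?_
    have n1 : 0 ≤ ε / 2 / K₁ * dens (z n) v x := mul_nonneg (by positivity) (dens_nonneg _ _ _)
    have n2 : 0 ≤ B * (ε / 4 / B / K₂) * psi N p m (val v x) (grad v x) :=
      mul_nonneg (by positivity) (psi_nonneg _ _)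
    beta_reduce
    by_cases hxr : x ∈ Metric.closedBall (0 : RN N) r
    · rw [indicator_of_mem hxr]
      have h1 : |val v x| ^ p ≤ psi N p m (val v x) (grad v x) := by
        unfold psi
        have : 0 ≤ |val v x| ^ pstar N p + ‖grad v x‖ ^ p + ‖grad v x‖ ^ m := by positivity
        linarith
      have h2 := (HC |val (z n) x| |val v x| (abs_nonneg _) (abs_nonneg _)).2
      have h3 : |W x| * (|val (z n) x| ^ (p - 1) * |val v x|) ≤
          B * (ε / 4 / B / K₂ * psi N p m (val v x) (grad v x) + C * |val (z n) x| ^ p) := by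
        refine mul_le_mul (hB x) (h2.trans ?_) (by positivity) hB0.le
        gcongr
      linarith
    · rw [indicator_of_notMem hxr]
      have hx : r < ‖x‖ := by simpa using hxr
      have h3 : |W x| * (|val (z n) x| ^ (p - 1) * |val v x|) ≤ ε / 2 / K₁ * dens (z n) v x :=
        mul_le_mul (hr x hx) (rpow_sub_one_mul_le_dens _ _ _) (by positivity) (by positivity)
      linarith
  have e1 := integral_add (i1.add i2) i3
  have e2 := integral_add i1 i2
  simp only [Pi.add_apply, integral_const_mul] at e1 e2
  rw [e1, e2] at key
  have b1 : ε / 2 / K₁ * ∫ x, dens (z n) v x ≤ ε / 2 / K₁ * (K₁ * 1) := by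
    gcongr
    exact (HK₁ _ (hR n) v).trans (by gcongr)
  have b2 : B * (ε / 4 / B / K₂) * ∫ x, psi N p m (val v x) (grad v x) ≤
      B * (ε / 4 / B / K₂) * K₂ := by
    gcongr
    exact HK₂ v hv
  have b3 : B * C * ∫ x, (Metric.closedBall (0 : RN N) r).indicator (fun x => |val (z n) x| ^ p) x ≤
      B * C * (ε / 4 / B / C) := by gcongr
  have s1 : ε / 2 / K₁ * (K₁ * 1) = ε / 2 := by field_simp
  have s2 : B * (ε / 4 / B / K₂) * K₂ = ε / 4 := by field_simp
  have s3 : B * C * (ε / 4 / B / C) = ε / 4 := by field_simp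
  linarith

end Decay

/-! ### Partial derivatives of functions of class `C²` -/

section Partial

variable {N : ℕ} {J : ℝ → RN N → ℝ}

theorem hasDerivAt_fst {F : Type*} [NormedAddCommGroup F] [NormedSpace ℝ F] {f : ℝ × RN N → F}
    {f' : ℝ × RN N →L[ℝ] F} {s : ℝ} {a : RN N} (hf : HasFDerivAt f f' (s, a)) :
    HasDerivAt (fun t => f (t, a)) (f' (1, 0)) s :=
  hf.comp_hasDerivAt s ((hasDerivAt_id s).prodMk (hasDerivAt_const s a))

theorem hasFDerivAt_snd {F : Type*} [NormedAddCommGroup F] [NormedSpace ℝ F] {f : ℝ × RN N → F}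
    {f' : ℝ × RN N →L[ℝ] F} {s : ℝ} {a : RN N} (hf : HasFDerivAt f f' (s, a)) :
    HasFDerivAt (fun b => f (s, b)) (f'.comp (ContinuousLinearMap.inr ℝ ℝ (RN N))) a :=
  hf.comp a (hasFDerivAt_prodMk_right s a)

theorem dS_eq (hJ : Differentiable ℝ (fun z : ℝ × RN N => J z.1 z.2)) (s : ℝ) (a : RN N) :
    dS J s a = fderiv ℝ (fun z : ℝ × RN N => J z.1 z.2) (s, a) (1, 0) :=
  (hasDerivAt_fst (hJ (s, a)).hasFDerivAt).deriv

theorem inner_dXi (hJ : Differentiable ℝ (fun z : ℝ × RN N => J z.1 z.2)) (s : ℝ) (a b : RN N) :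
    inner ℝ (dXi J s a) b = fderiv ℝ (fun z : ℝ × RN N => J z.1 z.2) (s, a) (0, b) := by
  have h : fderiv ℝ (J s) a = _ := (hasFDerivAt_snd (hJ (s, a)).hasFDerivAt).fderiv
  rw [dXi, gradient, InnerProductSpace.toDual_symm_apply, h]
  rfl

theorem dXi_eq (hJ : Differentiable ℝ (fun z : ℝ × RN N => J z.1 z.2)) (s : ℝ) (a : RN N) :
    dXi J s a = (InnerProductSpace.toDual ℝ (RN N)).symm
      ((fderiv ℝ (fun z : ℝ × RN N => J z.1 z.2) (s, a)).comp
        (ContinuousLinearMap.inr ℝ ℝ (RN N))) := by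
  have h : fderiv ℝ (J s) a = _ := (hasFDerivAt_snd (hJ (s, a)).hasFDerivAt).fderiv
  rw [dXi, gradient, h]

theorem contDiff_dS (hJ : ContDiff ℝ 2 (fun z : ℝ × RN N => J z.1 z.2)) :
    ContDiff ℝ 1 (fun z : ℝ × RN N => dS J z.1 z.2) := by
  have h : (fun z : ℝ × RN N => dS J z.1 z.2) =
      fun z => fderiv ℝ (fun z : ℝ × RN N => J z.1 z.2) z (1, 0) :=
    funext fun z => dS_eq (hJ.differentiable (by norm_num)) z.1 z.2
  rw [h]
  exact (hJ.fderiv_right (m := 1) (by norm_num)).clm_apply contDiff_const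

theorem contDiff_dXi (hJ : ContDiff ℝ 2 (fun z : ℝ × RN N => J z.1 z.2)) :
    ContDiff ℝ 1 (fun z : ℝ × RN N => dXi J z.1 z.2) := by
  have h : (fun z : ℝ × RN N => dXi J z.1 z.2) =
      fun z => (InnerProductSpace.toDual ℝ (RN N)).symm
        ((fderiv ℝ (fun z : ℝ × RN N => J z.1 z.2) z).comp
          (ContinuousLinearMap.inr ℝ ℝ (RN N))) :=
    funext fun z => dXi_eq (hJ.differentiable (by norm_num)) z.1 z.2
  rw [h]
  exact (InnerProductSpace.toDual ℝ (RN N)).symm.contDiff.comp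
    ((hJ.fderiv_right (m := 1) (by norm_num)).clm_comp contDiff_const)

theorem hasDerivAt_line (hJ : Differentiable ℝ (fun z : ℝ × RN N => J z.1 z.2))
    (s t : ℝ) (a b : RN N) (τ : ℝ) : HasDerivAt (fun r : ℝ => J (s + r * t) (a + r • b))
      (dS J (s + τ * t) (a + τ • b) * t + inner ℝ (dXi J (s + τ * t) (a + τ • b)) b) τ := by
  have h1 : HasDerivAt (fun r : ℝ => (s + r * t, a + r • b)) (t, b) τ := by
    have e1 : HasDerivAt (fun r : ℝ => s + r * t) t τ := by
      simpa using ((hasDerivAt_id τ).mul_const t).const_add s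
    have e2 : HasDerivAt (fun r : ℝ => a + r • b) b τ := by
      simpa using ((hasDerivAt_id τ).smul_const b).const_add a
    exact e1.prodMk e2
  have h2 := (hJ (s + τ * t, a + τ • b)).hasFDerivAt.comp_hasDerivAt τ h1
  have h3 : t • ((1, 0) : ℝ × RN N) + (0, b) = (t, b) := by simp
  rw [dS_eq hJ, inner_dXi hJ, mul_comm, ← smul_eq_mul, ← map_smul, ← map_add, h3]
  exact h2

/-- The increment of `J_ξ` in the scalar variable is controlled by `J_{sξ}`. -/
theorem norm_dXi_sub_le (hJ : ContDiff ℝ 2 (fun z : ℝ × RN N => J z.1 z.2)) {a : RN N} {K : ℝ}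
    (hK : ∀ s, ‖dXi (dS J) s a‖ ≤ K) (s t : ℝ) :
    ‖dXi J (s + t) a - dXi J s a‖ ≤ K * |t| := by
  have hd : Differentiable ℝ (fun z : ℝ × RN N => J z.1 z.2) := hJ.differentiable (by norm_num)
  have hd2 : Differentiable ℝ (fderiv ℝ (fun z : ℝ × RN N => J z.1 z.2)) :=
    (hJ.fderiv_right (m := 1) (by norm_num)).differentiable (by norm_num)
  have hdS : Differentiable ℝ (fun z : ℝ × RN N => dS J z.1 z.2) :=
    (contDiff_dS hJ).differentiable (by norm_num)
  have key : ∀ e : RN N, ‖inner ℝ (dXi J (s + t) a) e - inner ℝ (dXi J s a) e‖ ≤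
      K * ‖e‖ * ‖(s + t) - s‖ := by
    intro e
    refine Convex.norm_image_sub_le_of_norm_hasDerivWithin_le (s := univ)
      (f := fun r => inner ℝ (dXi J r a) e) (f' := fun r => inner ℝ (dXi (dS J) r a) e)
      (fun r _ => ?_) (fun r _ => ?_) convex_univ (mem_univ _) (mem_univ _)
    · have h1 := hasDerivAt_fst (f := fun z : ℝ × RN N =>
        fderiv ℝ (fun z : ℝ × RN N => J z.1 z.2) z (0, e)) (s := r) (a := a)
        ((hd2 (r, a)).hasFDerivAt.clm_apply (hasFDerivAt_const _ _))
      have h2 : HasFDerivAt (fun z : ℝ × RN N => dS J z.1 z.2) _ (r, a) :=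
        ((hd2 (r, a)).hasFDerivAt.clm_apply (hasFDerivAt_const (1, 0) _)).congr_of_eventuallyEq
          (Eventually.of_forall fun z => dS_eq hd z.1 z.2)
      have hs : IsSymmSndFDerivAt ℝ (fun z : ℝ × RN N => J z.1 z.2) (r, a) :=
        hJ.contDiffAt.isSymmSndFDerivAt (by simp)
      have e3 : inner ℝ (dXi (dS J) r a) e =
          fderiv ℝ (fderiv ℝ (fun z : ℝ × RN N => J z.1 z.2)) (r, a) (1, 0) (0, e) := by
        rw [inner_dXi hdS, h2.fderiv, hs.eq]
        simp
      rw [e3]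
      refine HasDerivAt.hasDerivWithinAt ?_
      have e4 : (fun r => inner ℝ (dXi J r a) e) = fun r =>
          fderiv ℝ (fun z : ℝ × RN N => J z.1 z.2) (r, a) (0, e) :=
        funext fun r => inner_dXi hd r a e
      rw [e4]
      simpa using h1
    · exact (norm_inner_le_norm _ _).trans (by gcongr; exact hK r)
  have h := key (dXi J (s + t) a - dXi J s a)
  rw [← inner_sub_left, real_inner_self_eq_norm_sq, add_sub_cancel_left, Real.norm_eq_abs,
    Real.norm_eq_abs, abs_of_nonneg (by positivity)] at h
  rcases (norm_nonneg (dXi J (s + t) a - dXi J s a)).eq_or_lt with h0 | h0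
  · rw [← h0]
    have := (norm_nonneg _).trans (hK s)
    positivity
  · have : ‖dXi J (s + t) a - dXi J s a‖ * ‖dXi J (s + t) a - dXi J s a‖ ≤
        ‖dXi J (s + t) a - dXi J s a‖ * (K * |t|) := by nlinarith
    exact le_of_mul_le_mul_left this h0

end Partial

/-! ### Increments of functions with polynomial growth -/

theorem exists_norm_add_sub_le_of_fderiv {ι E F : Type*} [NormedAddCommGroup E] [NormedSpace ℝ E]
    [NormedAddCommGroup F] [NormedSpace ℝ F] {f : ι → E → F} {k c ε : ℝ} (hk : 1 ≤ k) (hc : 0 < c)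
    (hf : ∀ i, Differentiable ℝ (f i)) (hf' : ∀ i x, ‖fderiv ℝ (f i) x‖ ≤ c * ‖x‖ ^ (k - 1))
    (hε : 0 < ε) :
    ∃ C : ℝ, 0 < C ∧ ∀ i x y, ‖f i (x + y) - f i x‖ ≤ ε * ‖x‖ ^ k + C * ‖y‖ ^ k := by
  obtain ⟨C, hC, H⟩ := exists_add_rpow_mul_le hk (show 0 < ε / c by positivity)
  refine ⟨c * C, by positivity, fun i x y => ?_⟩
  have h1 : ‖f i (x + y) - f i x‖ ≤ c * (‖x‖ + ‖y‖) ^ (k - 1) * ‖x + y - x‖ := by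
    refine (convex_closedBall (0 : E) (‖x‖ + ‖y‖)).norm_image_sub_le_of_norm_fderiv_le
      (𝕜 := ℝ) (fun z _ => (hf i) z) (fun z hz => ?_) ?_ ?_
    · rw [mem_closedBall_zero_iff] at hz
      refine (hf' i z).trans ?_
      gcongr
    · rw [mem_closedBall_zero_iff]
      linarith [norm_nonneg y]
    · rw [mem_closedBall_zero_iff]
      exact norm_add_le x y
  rw [add_sub_cancel_left, mul_assoc] at h1
  calc _ ≤ _ := h1
    _ ≤ c * (ε / c * ‖x‖ ^ k + C * ‖y‖ ^ k) := by
        gcongr; exact H _ _ (norm_nonneg _) (norm_nonneg _)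
    _ = _ := by field_simp

theorem exists_rpow_mul_min_le {k γ r ε : ℝ} (hk : 0 < k) (hkγ : k < γ) (hr : 0 < r)
    (hε : 0 < ε) :
    ∃ C : ℝ, 0 < C ∧ ∀ x y : ℝ, 0 ≤ x → 0 ≤ y →
      x ^ k * min 1 y ≤ ε * x ^ k + ε * x ^ γ + C * y ^ r := by
  obtain ⟨C, hC, H⟩ := exists_rpow_le_mul_rpow_add hk hkγ hε
  refine ⟨C / ε ^ r, by positivity, fun x y hx hy => ?_⟩
  have h1 := Real.rpow_nonneg hx k
  have h2 := Real.rpow_nonneg hx γ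
  have h3 := Real.rpow_nonneg hy r
  rcases le_total y ε with h | h
  · have h4 : x ^ k * min 1 y ≤ x ^ k * ε := by
      gcongr; exact (min_le_right _ _).trans h
    have : 0 ≤ ε * x ^ γ + C / ε ^ r * y ^ r := by positivity
    linarith
  · have h4 : x ^ k * min 1 y ≤ x ^ k * 1 := by gcongr; exact min_le_left _ _
    have h5 : C ≤ C / ε ^ r * y ^ r := by
      rw [div_mul_eq_mul_div, le_div_iff₀ (by positivity)]
      gcongr
    have := H x hx
    have : 0 ≤ ε * x ^ k := by positivity
    linarith

/-! ### The power nonlinearity -/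

section Power

variable {N : ℕ} {p m : ℝ}

theorem abs_abs_rpow_mul_self (hp : 2 < p) (s : ℝ) : |(|s| ^ (p - 2) * s)| = |s| ^ (p - 1) := by
  rcases eq_or_ne s 0 with rfl | hs
  · rw [mul_zero, abs_zero, Real.zero_rpow (by linarith)]
  · rw [abs_mul, abs_of_nonneg (by positivity), ← Real.rpow_add_one (abs_ne_zero.2 hs)]
    congr 1; ring

theorem exists_abs_rpow_mul_self_sub_le (hp : 2 < p) {ε : ℝ} (hε : 0 < ε) :
    ∃ C : ℝ, 0 < C ∧ ∀ s t : ℝ, |(|s + t| ^ (p - 2) * (s + t) - |s| ^ (p - 2) * s)| ≤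
      ε * |s| ^ (p - 1) + C * |t| ^ (p - 1) := by
  have hc : Continuous (fun s : ℝ => |s| ^ (p - 2) * s) :=
    (Continuous.rpow_const (by fun_prop) fun _ => Or.inr (by linarith)).mul continuous_id
  obtain ⟨δ, hδ, H⟩ := Metric.continuousAt_iff.1 (hc.continuousAt (x := 1)) ε hε
  refine ⟨2 * (1 / δ + 1) ^ (p - 1), by positivity, fun s t => ?_⟩
  have t0 : 0 ≤ |t| ^ (p - 1) := by positivity
  have s0 : 0 ≤ |s| ^ (p - 1) := by positivity
  rcases lt_or_ge |t| (δ * |s|) with h | h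
  · have hs : s ≠ 0 := by
      rintro rfl
      rw [abs_zero, mul_zero] at h
      exact absurd h (abs_nonneg t).not_gt
    have h1 : dist (1 + t / s) 1 < δ := by
      rw [Real.dist_eq, add_sub_cancel_left, abs_div, div_lt_iff₀ (abs_pos.2 hs)]
      exact h
    have h2 := H h1
    rw [Real.dist_eq, abs_one, Real.one_rpow, one_mul] at h2
    have e1 : s + t = s * (1 + t / s) := by field_simp
    have e2 : |s + t| ^ (p - 2) * (s + t) - |s| ^ (p - 2) * s =
        |s| ^ (p - 2) * s * (|1 + t / s| ^ (p - 2) * (1 + t / s) - 1) := by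
      rw [e1, abs_mul, Real.mul_rpow (abs_nonneg _) (abs_nonneg _)]; ring
    rw [e2, abs_mul, abs_abs_rpow_mul_self hp]
    have : |s| ^ (p - 1) * |(|1 + t / s| ^ (p - 2) * (1 + t / s) - 1)| ≤ |s| ^ (p - 1) * ε := by
      gcongr
    have : 0 ≤ 2 * (1 / δ + 1) ^ (p - 1) * |t| ^ (p - 1) := by positivity
    linarith
  · have h1 : |s| ≤ 1 / δ * |t| := by rw [one_div_mul_eq_div, le_div_iff₀ hδ]; linarith
    have h2 : |s + t| ^ (p - 1) ≤ ((1 / δ + 1) * |t|) ^ (p - 1) :=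
      Real.rpow_le_rpow (abs_nonneg _) (by linarith [abs_add_le s t]) (by linarith)
    have h3 : |s| ^ (p - 1) ≤ ((1 / δ + 1) * |t|) ^ (p - 1) :=
      Real.rpow_le_rpow (abs_nonneg _) (by linarith [abs_nonneg t]) (by linarith)
    rw [Real.mul_rpow (by positivity) (abs_nonneg _)] at h2 h3
    have h4 := abs_sub (|s + t| ^ (p - 2) * (s + t)) (|s| ^ (p - 2) * s)
    rw [abs_abs_rpow_mul_self hp, abs_abs_rpow_mul_self hp] at h4
    have : 0 ≤ ε * |s| ^ (p - 1) := by positivity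
    linarith

theorem admissible_power (h : Exponents N p m) :
    Admissible N p m (fun s _ => |s| ^ p / p) (fun s _ => |s| ^ (p - 2) * s) (fun _ _ => 0) where
  continuous := by
    refine Continuous.div_const ?_ _
    exact Continuous.rpow_const (by fun_prop) fun _ => Or.inr (by linarith [h.two_lt_p])
  continuous_S := by
    refine Continuous.mul ?_ continuous_fst
    exact Continuous.rpow_const (by fun_prop) fun _ => Or.inr (by linarith [h.two_lt_p])
  continuous_X := continuous_const
  hasDerivAt s t a b τ := by
    have hp := h.two_lt_p
    have e1 : HasDerivAt (fun r : ℝ => s + r * t) t τ := by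
      simpa using ((hasDerivAt_id τ).mul_const t).const_add s
    have e2 := ((hasDerivAt_abs_rpow (s + τ * t) (show 1 < p by linarith)).comp τ e1).div_const p
    rw [inner_zero_left, add_zero]
    have hp0 : p ≠ 0 := (show 0 < p by linarith).ne'
    have e3 : |s + τ * t| ^ (p - 2) * (s + τ * t) * t =
        p * |s + τ * t| ^ (p - 2) * (s + τ * t) * t / p := by field_simp
    rw [e3]
    exact e2
  bound := by
    have hp := h.two_lt_p
    refine ⟨1, one_pos, fun s a => ?_⟩
    rw [abs_of_nonneg (by positivity), one_mul]
    have h1 : |s| ^ p / p ≤ |s| ^ p := div_le_self (by positivity) (by linarith)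
    have : 0 ≤ |s| ^ pstar N p + ‖a‖ ^ p + ‖a‖ ^ m := by positivity
    unfold psi
    linarith
  bound_deriv := by
    refine ⟨1, one_pos, fun s a => ⟨?_, ?_⟩⟩
    · rw [abs_abs_rpow_mul_self h.two_lt_p, one_mul]
      have : 0 ≤ |s| ^ (pstar N p - 1) + ‖a‖ ^ (p - 1) + ‖a‖ ^ (p - 1 + p / N) := by positivity
      unfold phiS
      linarith
    · rw [norm_zero, one_mul]
      exact phiX_nonneg _ _
  split ε hε := by
    obtain ⟨C, hC, H⟩ := exists_abs_rpow_mul_self_sub_le h.two_lt_p hε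
    have le : ∀ (s : ℝ) (a : RN N), |s| ^ (p - 1) ≤ phiS N p s a := fun s a => by
      have : 0 ≤ |s| ^ (pstar N p - 1) + ‖a‖ ^ (p - 1) + ‖a‖ ^ (p - 1 + p / N) := by positivity
      unfold phiS
      linarith
    refine ⟨C, hC, fun s t a b => ⟨(H s t).trans ?_, ?_⟩⟩
    · gcongr
      · exact le s a
      · exact le t b
    · rw [sub_self, norm_zero]
      exact add_nonneg (mul_nonneg hε.le (phiX_nonneg _ _)) (mul_nonneg hC.le (phiX_nonneg _ _))

end Power

/-! ### The integrand `j` -/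

namespace Assumptions

variable {N : ℕ} {p m σ ν C : ℝ} {L : RN N → ℝ} {M : ℝ → RN N → ℝ} {G : ℝ → ℝ}

theorem exponents (H : Assumptions N p m σ ν C L M G) : Exponents N p m :=
  ⟨H.two_le_m, H.m_lt_p, H.p_lt_N, H.m_ge, H.m_lt⟩

theorem contDiff_jFun (H : Assumptions N p m σ ν C L M G) :
    ContDiff ℝ 2 (fun z : ℝ × RN N => jFun L M G z.1 z.2) :=
  ((H.L_C2.comp contDiff_snd).add H.M_C2).sub (H.G_C2.comp contDiff_fst)

theorem differentiable_M (H : Assumptions N p m σ ν C L M G) :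
    Differentiable ℝ (fun z : ℝ × RN N => M z.1 z.2) := H.M_C2.differentiable (by norm_num)

theorem dS_jFun (H : Assumptions N p m σ ν C L M G) (s : ℝ) (a : RN N) :
    dS (jFun L M G) s a = dS M s a - deriv G s := by
  have h1 : DifferentiableAt ℝ (fun t => M t a) s :=
    (hasDerivAt_fst (H.differentiable_M (s, a)).hasFDerivAt).differentiableAt
  have h2 : DifferentiableAt ℝ G s := H.G_C2.differentiable (by norm_num) s
  exact ((h1.hasDerivAt.const_add (L a)).sub h2.hasDerivAt).deriv

theorem dXi_jFun (H : Assumptions N p m σ ν C L M G) (s : ℝ) (a : RN N) :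
    dXi (jFun L M G) s a = gradient L a + dXi M s a := by
  have h1 : DifferentiableAt ℝ (M s) a :=
    (hasFDerivAt_snd (H.differentiable_M (s, a)).hasFDerivAt).differentiableAt
  have h2 : DifferentiableAt ℝ L a := H.L_C2.differentiable (by norm_num) a
  have h3 : HasFDerivAt (jFun L M G s) (fderiv ℝ L a + fderiv ℝ (M s) a) a :=
    (h2.hasFDerivAt.add h1.hasFDerivAt).sub_const (G s)
  rw [dXi, dXi, gradient, gradient, gradient, h3.fderiv, map_add]

theorem rpow_σ_le (H : Assumptions N p m σ ν C L M G) {x : ℝ} (hx : 0 ≤ x) :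
    x ^ σ ≤ x ^ p + x ^ pstar N p :=
  rpow_le_add_rpow hx (by linarith [H.two_le_m, H.m_lt_p]) H.p_lt_σ.le H.σ_lt.le

theorem rpow_σ_sub_one_le (H : Assumptions N p m σ ν C L M G) {x : ℝ} (hx : 0 ≤ x) :
    x ^ (σ - 1) ≤ x ^ (p - 1) + x ^ (pstar N p - 1) :=
  rpow_le_add_rpow hx (by linarith [H.two_le_m, H.m_lt_p]) (by linarith [H.p_lt_σ])
    (by have := H.σ_lt; unfold pstar; linarith)

theorem abs_G_le (H : Assumptions N p m σ ν C L M G) (s : ℝ) : |G s| ≤ (|C| + 1) * |s| ^ σ := by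
  have hσ : 1 ≤ σ - 1 := by linarith [H.two_le_m, H.m_lt_p, H.p_lt_σ]
  have h1 : ‖G s - G 0‖ ≤ (|C| + 1) * |s| ^ (σ - 1) * ‖s - 0‖ := by
    refine (convex_closedBall (0 : ℝ) |s|).norm_image_sub_le_of_norm_deriv_le
      (𝕜 := ℝ) (fun z _ => H.G_C2.differentiable (by norm_num) z) (fun z hz => ?_) ?_ ?_
    · rw [mem_closedBall_zero_iff, Real.norm_eq_abs] at hz
      refine (H.G_s z).trans ?_
      gcongr
      · linarith [le_abs_self C]
    · simp
    · simp
  rw [H.G_zero, sub_zero, sub_zero, Real.norm_eq_abs, Real.norm_eq_abs, mul_assoc] at h1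
  refine h1.trans (le_of_eq ?_)
  rcases eq_or_ne s 0 with rfl | hs
  · rw [abs_zero, mul_zero, Real.zero_rpow (by linarith)]
  · rw [← Real.rpow_add_one (abs_ne_zero.2 hs), sub_add_cancel]

theorem bound_jFun (H : Assumptions N p m σ ν C L M G) (s : ℝ) (a : RN N) :
    |jFun L M G s a| ≤ (|C| + 1) * psi N p m s a := by
  have hC := le_abs_self C
  have h1 := (H.L_upper a).trans
    (mul_le_mul_of_nonneg_right (show C ≤ |C| + 1 by linarith) (by positivity))
  have h2 : |M s a| ≤ (|C| + 1) * ‖a‖ ^ m := by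
    rw [abs_of_nonneg ((mul_nonneg H.ν_pos.le (by positivity)).trans (H.M_lower s a))]
    exact (H.M_upper s a).trans
      (mul_le_mul_of_nonneg_right (show C ≤ |C| + 1 by linarith) (by positivity))
  have h3 := (H.abs_G_le s).trans
    (mul_le_mul_of_nonneg_left (H.rpow_σ_le (abs_nonneg s)) (by positivity))
  have h4 := abs_sub (L a + M s a) (G s)
  have h5 := abs_add_le (L a) (M s a)
  unfold jFun psi
  linarith

theorem bound_deriv_jFun (H : Assumptions N p m σ ν C L M G) (s : ℝ) (a : RN N) :
    |dS (jFun L M G) s a| ≤ (|C| + 1) * phiS N p s a ∧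
      ‖dXi (jFun L M G) s a‖ ≤ (|C| + 1) * phiX N p m s a := by
  have hC : C ≤ |C| + 1 := by linarith [le_abs_self C]
  have hC0 : 0 < |C| + 1 := by positivity
  constructor
  · have h1 := (H.M_s s a).trans (mul_le_mul_of_nonneg_right hC (by positivity))
    have h2 := h1.trans
      (mul_le_mul_of_nonneg_left (H.exponents.rpow_m_le (norm_nonneg a)) hC0.le)
    have h3 := (H.G_s s).trans (mul_le_mul_of_nonneg_right hC (by positivity))
    have h4 := h3.trans (mul_le_mul_of_nonneg_left (H.rpow_σ_sub_one_le (abs_nonneg s)) hC0.le)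
    have h5 := abs_sub (dS M s a) (deriv G s)
    rw [H.dS_jFun]
    unfold phiS
    linarith
  · have h1 := (H.L_xi a).trans (mul_le_mul_of_nonneg_right hC (by positivity))
    have h2 := (H.M_xi s a).trans (mul_le_mul_of_nonneg_right hC (by positivity))
    have h3 := norm_add_le (gradient L a) (dXi M s a)
    have h4 : 0 ≤ (|C| + 1) * |s| ^ (p - 1) := by positivity
    rw [H.dXi_jFun]
    unfold phiX
    linarith

theorem differentiable_gradient_L (H : Assumptions N p m σ ν C L M G) :
    Differentiable ℝ (gradient L) :=
  (InnerProductSpace.toDual ℝ (RN N)).symm.differentiable.comp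
    ((H.L_C2.fderiv_right (m := 1) (by norm_num)).differentiable (by norm_num))

/-- The increments of `j_ξ`. -/
theorem split_dXi (H : Assumptions N p m σ ν C L M G) {ε : ℝ} (hε : 0 < ε) :
    ∃ D : ℝ, 0 < D ∧ ∀ (s t : ℝ) (a b : RN N),
      ‖dXi (jFun L M G) (s + t) (a + b) - dXi (jFun L M G) s a‖ ≤
        ε * phiX N p m s a + D * phiX N p m t b := by
  have hm := H.two_le_m
  have hmp := H.m_lt_p
  set c := |C| + 1 with hc
  have hcC : C ≤ c := by linarith [le_abs_self C]
  have hc0 : 0 < c := by positivity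
  set η := ε / (1 + 4 * c) with hη
  have hη0 : 0 < η := by positivity
  obtain ⟨D₁, d1, H1⟩ := exists_norm_add_sub_le_of_fderiv (ι := Unit) (f := fun _ => gradient L)
    (k := p - 1) (c := c) (by linarith) hc0 (fun _ => H.differentiable_gradient_L)
    (fun _ x => (H.L_xi_xi x).trans (by
      rw [show p - 1 - 1 = p - 2 by ring]
      exact mul_le_mul_of_nonneg_right hcC (by positivity))) hη0
  have hdX : ∀ s, Differentiable ℝ (dXi M s) := fun s a =>
    (hasFDerivAt_snd (((contDiff_dXi H.M_C2).differentiable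
      (by norm_num)) (s, a)).hasFDerivAt).differentiableAt
  obtain ⟨D₂, d2, H2⟩ := exists_norm_add_sub_le_of_fderiv (f := dXi M)
    (k := m - 1) (c := c) (by linarith) hc0 hdX
    (fun s x => (H.M_xi_xi s x).trans (by
      rw [show m - 1 - 1 = m - 2 by ring]
      exact mul_le_mul_of_nonneg_right hcC (by positivity))) hη0
  obtain ⟨D₃, d3, H3⟩ := exists_rpow_mul_min_le (k := m - 1) (γ := p - 1) (r := p - 1)
    (by linarith) (by linarith) (by linarith) hη0
  refine ⟨D₁ + D₂ + 2 * c * D₃, by positivity, fun s t a b => ?_⟩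
  have e1 := H1 () a b
  have e2 := H2 (s + t) a b
  have e3 := H3 ‖a‖ |t| (norm_nonneg _) (abs_nonneg _)
  have e4 : ‖dXi M (s + t) a - dXi M s a‖ ≤ 2 * c * (‖a‖ ^ (m - 1) * min 1 |t|) := by
    have a0 : 0 ≤ ‖a‖ ^ (m - 1) := by positivity
    have b1 : ‖dXi M (s + t) a - dXi M s a‖ ≤ c * ‖a‖ ^ (m - 1) * |t| :=
      norm_dXi_sub_le H.M_C2 (fun s => (H.M_s_xi s a).trans
        (mul_le_mul_of_nonneg_right hcC a0)) s t
    have b2 : ∀ s, ‖dXi M s a‖ ≤ c * ‖a‖ ^ (m - 1) := fun s =>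
      (H.M_xi s a).trans (mul_le_mul_of_nonneg_right hcC a0)
    have b3 := (norm_sub_le (dXi M (s + t) a) (dXi M s a)).trans (add_le_add (b2 _) (b2 _))
    have b4 : 0 ≤ c * ‖a‖ ^ (m - 1) * |t| := by positivity
    rcases le_total 1 |t| with h | h
    · rw [min_eq_left h]; linarith
    · rw [min_eq_right h]; linarith
  have e5 : dXi (jFun L M G) (s + t) (a + b) - dXi (jFun L M G) s a =
      (gradient L (a + b) - gradient L a) + (dXi M (s + t) (a + b) - dXi M (s + t) a) +
        (dXi M (s + t) a - dXi M s a) := by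
    rw [H.dXi_jFun, H.dXi_jFun]; abel
  have e6 := norm_add₃_le (a := gradient L (a + b) - gradient L a)
    (b := dXi M (s + t) (a + b) - dXi M (s + t) a) (c := dXi M (s + t) a - dXi M s a)
  rw [← e5] at e6
  have e7 : 2 * c * (‖a‖ ^ (m - 1) * min 1 |t|) ≤ 2 * c * (η * ‖a‖ ^ (m - 1) +
      η * ‖a‖ ^ (p - 1) + D₃ * |t| ^ (p - 1)) := by gcongr
  have hε' : ε = η * (1 + 4 * c) := by rw [hη]; field_simp
  have n1 : 0 ≤ ‖a‖ ^ (p - 1) := by positivity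
  have n2 : 0 ≤ ‖a‖ ^ (m - 1) := by positivity
  have n3 : 0 ≤ |s| ^ (p - 1) := by positivity
  have n4 : 0 ≤ ‖b‖ ^ (p - 1) := by positivity
  have n5 : 0 ≤ ‖b‖ ^ (m - 1) := by positivity
  have n6 : 0 ≤ |t| ^ (p - 1) := by positivity
  have hηc : 0 < η * c := by positivity
  have hcD : 0 < c * D₃ := by positivity
  have m1 := mul_nonneg hηc.le n1
  have m2 := mul_nonneg hηc.le n2
  have m3 := mul_nonneg hηc.le n3
  have m4 := mul_nonneg hη0.le n3
  have m5 := mul_nonneg d1.le n6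
  have m6 := mul_nonneg d2.le n6
  have m7 := mul_nonneg d1.le n5
  have m8 := mul_nonneg d2.le n4
  have m9 := mul_nonneg hcD.le n4
  have m10 := mul_nonneg hcD.le n5
  rw [hε']
  unfold phiX
  linarith

/-- The increments of `j_s`. -/
theorem split_dS (H : Assumptions N p m σ ν C L M G) {ε : ℝ} (hε : 0 < ε) :
    ∃ D : ℝ, 0 < D ∧ ∀ (s t : ℝ) (a b : RN N),
      |dS (jFun L M G) (s + t) (a + b) - dS (jFun L M G) s a| ≤
        ε * phiS N p s a + D * phiS N p t b := by
  have hm := H.two_le_m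
  have hmp := H.m_lt_p
  have hmβ := H.m_lt
  have hpσ := H.p_lt_σ
  set c := |C| + 1 with hc
  have hcC : C ≤ c := by linarith [le_abs_self C]
  have hc0 : 0 < c := by positivity
  set η := ε / (1 + 4 * c) with hη
  have hη0 : 0 < η := by positivity
  have hdG : Differentiable ℝ (deriv G) :=
    (((contDiff_succ_iff_deriv (n := 1)).1 (H.G_C2.of_le one_add_one_eq_two.le)).2.2).differentiable
      (by norm_num)
  obtain ⟨D₁, d1, H1⟩ := exists_norm_add_sub_le_of_fderiv (ι := Unit) (f := fun _ => deriv G)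
    (k := σ - 1) (c := c) (by linarith) hc0 (fun _ => hdG)
    (fun _ x => by
      rw [show σ - 1 - 1 = σ - 2 by ring, ← norm_deriv_eq_norm_fderiv]
      exact (H.G_s_s x).trans (mul_le_mul_of_nonneg_right hcC (by positivity))) hη0
  have hdS : Differentiable ℝ (fun z : ℝ × RN N => dS M z.1 z.2) :=
    (contDiff_dS H.M_C2).differentiable (by norm_num)
  obtain ⟨D₂, d2, H2⟩ := exists_norm_add_sub_le_of_fderiv (f := dS M)
    (k := m) (c := c) (by linarith) hc0
    (fun s a => (hasFDerivAt_snd (hdS (s, a)).hasFDerivAt).differentiableAt)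
    (fun s x => by
      have := (H.M_s_xi s x).trans (mul_le_mul_of_nonneg_right hcC (by positivity))
      rwa [dXi, gradient, LinearIsometryEquiv.norm_map] at this) hη0
  obtain ⟨D₃, d3, H3⟩ := exists_rpow_mul_min_le (k := m) (γ := p - 1 + p / N) (r := p - 1)
    (by linarith) hmβ (by linarith) hη0
  refine ⟨D₁ + D₂ + 2 * c * D₃, by positivity, fun s t a b => ?_⟩
  have e1 := H1 () s t
  have e2 := H2 (s + t) a b
  have e3 := H3 ‖a‖ |t| (norm_nonneg _) (abs_nonneg _)
  have e4 : |dS M (s + t) a - dS M s a| ≤ 2 * c * (‖a‖ ^ m * min 1 |t|) := by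
    have a0 : 0 ≤ ‖a‖ ^ m := by positivity
    have b1 : ‖dS M (s + t) a - dS M s a‖ ≤ c * ‖a‖ ^ m * ‖s + t - s‖ :=
      Convex.norm_image_sub_le_of_norm_deriv_le (s := univ) (𝕜 := ℝ) (f := fun r => dS M r a)
        (fun r _ => (hasDerivAt_fst (hdS (r, a)).hasFDerivAt).differentiableAt)
        (fun r _ => (H.M_s_s r a).trans (mul_le_mul_of_nonneg_right hcC a0))
        convex_univ (mem_univ _) (mem_univ _)
    rw [add_sub_cancel_left, Real.norm_eq_abs, Real.norm_eq_abs] at b1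
    have b2 : ∀ s, |dS M s a| ≤ c * ‖a‖ ^ m := fun s =>
      (H.M_s s a).trans (mul_le_mul_of_nonneg_right hcC a0)
    have b3 := (abs_sub (dS M (s + t) a) (dS M s a)).trans (add_le_add (b2 _) (b2 _))
    have b4 : 0 ≤ c * ‖a‖ ^ m * |t| := by positivity
    rcases le_total 1 |t| with h | h
    · rw [min_eq_left h]; linarith
    · rw [min_eq_right h]; linarith
  have e5 : dS (jFun L M G) (s + t) (a + b) - dS (jFun L M G) s a =
      -(deriv G (s + t) - deriv G s) + (dS M (s + t) (a + b) - dS M (s + t) a) +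
        (dS M (s + t) a - dS M s a) := by
    rw [H.dS_jFun, H.dS_jFun]; ring
  have e6 := abs_add_three (-(deriv G (s + t) - deriv G s))
    (dS M (s + t) (a + b) - dS M (s + t) a) (dS M (s + t) a - dS M s a)
  rw [← e5, abs_neg] at e6
  have e7 : 2 * c * (‖a‖ ^ m * min 1 |t|) ≤ 2 * c * (η * ‖a‖ ^ m +
      η * ‖a‖ ^ (p - 1 + p / N) + D₃ * |t| ^ (p - 1)) := by gcongr
  simp only [Real.norm_eq_abs] at e1 e2
  have hε' : ε = η * (1 + 4 * c) := by rw [hη]; field_simp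
  have hηc : 0 < η * c := by positivity
  have hcD : 0 < c * D₃ := by positivity
  have f1 := mul_le_mul_of_nonneg_left (H.rpow_σ_sub_one_le (abs_nonneg s)) hη0.le
  have f2 := mul_le_mul_of_nonneg_left (H.rpow_σ_sub_one_le (abs_nonneg t)) d1.le
  have f3 := mul_le_mul_of_nonneg_left (H.exponents.rpow_m_le (norm_nonneg a)) hη0.le
  have f4 := mul_le_mul_of_nonneg_left (H.exponents.rpow_m_le (norm_nonneg a)) hηc.le
  have f5 := mul_le_mul_of_nonneg_left (H.exponents.rpow_m_le (norm_nonneg b)) d2.le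
  have pos : ∀ {x : ℝ} (k : ℝ), 0 ≤ x → 0 ≤ η * c * x ^ k ∧ 0 ≤ η * x ^ k ∧ 0 ≤ D₁ * x ^ k ∧
      0 ≤ D₂ * x ^ k ∧ 0 ≤ c * D₃ * x ^ k := fun k hx =>
    ⟨by positivity, by positivity, by positivity, by positivity, by positivity⟩
  have n1 := pos (p - 1) (norm_nonneg a)
  have n2 := pos (p - 1 + p / N) (norm_nonneg a)
  have n3 := pos (p - 1) (abs_nonneg s)
  have n4 := pos (pstar N p - 1) (abs_nonneg s)
  have n5 := pos (p - 1) (norm_nonneg b)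
  have n6 := pos (p - 1 + p / N) (norm_nonneg b)
  have n7 := pos (p - 1) (abs_nonneg t)
  have n8 := pos (pstar N p - 1) (abs_nonneg t)
  rw [hε']
  unfold phiS
  linarith

theorem admissible_jFun (H : Assumptions N p m σ ν C L M G) :
    Admissible N p m (jFun L M G) (dS (jFun L M G)) (dXi (jFun L M G)) where
  continuous := H.contDiff_jFun.continuous
  continuous_S := (contDiff_dS H.contDiff_jFun).continuous
  continuous_X := (contDiff_dXi H.contDiff_jFun).continuous
  hasDerivAt := hasDerivAt_line (H.contDiff_jFun.differentiable (by norm_num))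
  bound := ⟨|C| + 1, by positivity, H.bound_jFun⟩
  bound_deriv := ⟨|C| + 1, by positivity, H.bound_deriv_jFun⟩
  split ε hε := by
    obtain ⟨D₁, d1, H1⟩ := H.split_dS hε
    obtain ⟨D₂, d2, H2⟩ := H.split_dXi hε
    refine ⟨D₁ + D₂, by positivity, fun s t a b => ⟨(H1 s t a b).trans ?_, (H2 s t a b).trans ?_⟩⟩
    · have := mul_nonneg d2.le (phiS_nonneg (p := p) t b)
      linarith
    · have := mul_nonneg d1.le (phiX_nonneg (p := p) (m := m) t b)
      linarith

end Assumptions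

theorem tendsto_dual_add_zero {E : Type*} [AddCommGroup E] [Module ℝ E] [TopologicalSpace E]
    {a b d e g w : ℕ → StrongDual ℝ E} {c f : StrongDual ℝ E}
    (h1 : Tendsto (fun n => a n - b n + c) atTop (𝓝 0)) (hw : Tendsto w atTop (𝓝 0))
    (h2 : Tendsto (fun n => e n - d n + f) atTop (𝓝 0))
    (h3 : Tendsto (fun n => g n - e n) atTop (𝓝 0)) (heq : ∀ n, w n = b n + d n)
    (hcf : c + f = 0) : Tendsto (fun n => a n + g n) atTop (𝓝 0) := by
  have total := ((h1.add hw).add h2).add h3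
  simp only [add_zero] at total
  refine total.congr fun n => ?_
  rw [heq n, eq_neg_of_add_eq_zero_left hcf]
  abel

/-! ### The functionals and forms of the problem -/

section Bridge

variable {N : ℕ} {p m : ℝ} {Ω : TopologicalSpace.Opens (RN N)} {V : RN N → ℝ} {Vinf : ℝ}

theorem psi_zero (h : Exponents N p m) : psi N p m 0 0 = 0 := by
  have hp := h.two_lt_p
  have hP := h.p_lt_pstar
  have hm := h.two_le_m
  unfold psi
  rw [abs_zero, norm_zero, Real.zero_rpow (by linarith), Real.zero_rpow (by linarith),
    Real.zero_rpow (by linarith)]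
  simp

theorem Admissible.apply_zero {J JS : ℝ → RN N → ℝ} {JX : ℝ → RN N → RN N}
    (hJ : Admissible N p m J JS JX) (h : Exponents N p m) : J 0 0 = 0 := by
  obtain ⟨K, -, H⟩ := hJ.bound
  have := H 0 0
  rw [psi_zero h, mul_zero] at this
  exact abs_nonpos_iff.1 this

theorem bddWeight_const (c : ℝ) : BddWeight (fun _ : RN N => c) :=
  ⟨aestronglyMeasurable_const, |c| + 1, by positivity, fun _ => by linarith⟩

theorem PotentialAssumptions.bddWeight_indicator_sub (hV : PotentialAssumptions Ω V Vinf) (c : ℝ) :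
    BddWeight ((Ω : Set (RN N)).indicator fun x => c - V x) := by
  obtain ⟨V₀, h0, hV₀⟩ := hV.pos
  obtain ⟨V₁, hV₁⟩ := hV.bddAbove
  refine ⟨?_, |c| + |V₁| + 1, by positivity, fun x => ?_⟩
  · rw [aestronglyMeasurable_indicator_iff Ω.isOpen.measurableSet]
    exact (continuousOn_const.sub hV.continuousOn).aestronglyMeasurable Ω.isOpen.measurableSet
  · by_cases hx : x ∈ (Ω : Set (RN N))
    · rw [indicator_of_mem hx]
      have h1 := hV₀ x hx
      have h2 : V x ≤ V₁ := hV₁ ⟨x, hx, rfl⟩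
      have h3 : |V x| ≤ |V₁| := abs_le_abs_of_nonneg (by linarith) h2
      linarith [abs_sub c (V x)]
    · rw [indicator_of_notMem hx, abs_zero]
      positivity

theorem PotentialAssumptions.bddWeight (hV : PotentialAssumptions Ω V Vinf) :
    BddWeight ((Ω : Set (RN N)).indicator V) := by
  obtain ⟨h1, B, h2, h3⟩ := hV.bddWeight_indicator_sub 0
  have e : (Ω : Set (RN N)).indicator V =
      fun x => -((Ω : Set (RN N)).indicator (fun x => 0 - V x) x) := by
    funext x
    by_cases hx : x ∈ (Ω : Set (RN N)) <;> simp [hx]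
  rw [e]
  exact ⟨h1.neg, B, h2, fun x => by rw [abs_neg]; exact h3 x⟩

theorem PotentialAssumptions.decay (hV : PotentialAssumptions Ω V Vinf) (ε : ℝ) (hε : 0 < ε) :
    ∃ r : ℝ, ∀ x, r < ‖x‖ → |(Ω : Set (RN N)).indicator (fun x => Vinf - V x) x| ≤ ε := by
  have h := hV.tendsto.eventually (Metric.closedBall_mem_nhds Vinf hε)
  rw [eventually_inf_principal] at h
  obtain ⟨r, -, hr⟩ := (Metric.hasBasis_cobounded_compl_closedBall (0 : RN N)).eventually_iff.1 h
  refine ⟨r, fun x hx => ?_⟩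
  by_cases hxΩ : x ∈ (Ω : Set (RN N))
  · rw [indicator_of_mem hxΩ, abs_sub_comm]
    exact hr (by simpa using hx) hxΩ
  · rw [indicator_of_notMem hxΩ, abs_zero]
    exact hε.le

variable [Fact (1 ≤ ENNReal.ofReal p)] [Fact (1 ≤ ENNReal.ofReal m)]

theorem formXi_eq (j : ℝ → RN N → ℝ) (z v : X Ω p m) :
    formXi j z v = ∫ x, (1 : ℝ) * inner ℝ (dXi j (val z x) (grad z x)) (grad v x) := by
  simp only [one_mul]
  refine setIntegral_eq_integral_of_ae_compl_eq_zero ?_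
  filter_upwards [ae_eq_zero_of_notMem v] with x hx hxΩ
  rw [(hx hxΩ).2, inner_zero_right]

theorem formS_eq (j : ℝ → RN N → ℝ) (z v : X Ω p m) :
    formS j z v = ∫ x, (1 : ℝ) * (dS j (val z x) (grad z x) * val v x) := by
  simp only [one_mul]
  refine setIntegral_eq_integral_of_ae_compl_eq_zero ?_
  filter_upwards [ae_eq_zero_of_notMem v] with x hx hxΩ
  rw [(hx hxΩ).1, mul_zero]

theorem formS_add_formXi_eq {j : ℝ → RN N → ℝ} (h : Exponents N p m)
    (hj : Admissible N p m j (dS j) (dXi j)) (z v : X Ω p m) :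
    formS j z v + formXi j z v = hj.form h (bddWeight_const 1) z v := by
  rw [hj.form_apply_eq_add, formS_eq, formXi_eq]

theorem formV_eq (h : Exponents N p m) (hV : PotentialAssumptions Ω V Vinf) (z v : X Ω p m) :
    formV V z v = (admissible_power h).form h hV.bddWeight z v := by
  rw [Admissible.form_apply, formV, ← integral_indicator Ω.isOpen.measurableSet]
  congr 1
  funext x
  by_cases hx : x ∈ (Ω : Set (RN N))
  · simp only [indicator_of_mem hx, pairing, inner_zero_left]; ring
  · simp only [indicator_of_notMem hx, zero_mul]

theorem formV_const_eq (h : Exponents N p m) (c : ℝ) (z v : X Ω p m) :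
    formV (fun _ => c) z v = (admissible_power h).form h (bddWeight_const c) z v := by
  rw [Admissible.form_apply, formV, setIntegral_eq_integral_of_ae_compl_eq_zero]
  · congr 1
    funext x
    simp only [pairing, inner_zero_left]; ring
  · filter_upwards [ae_eq_zero_of_notMem v] with x hx hxΩ
    rw [(hx hxΩ).1, mul_zero]

theorem form_add_form_apply {j : ℝ → RN N → ℝ} (h : Exponents N p m)
    (hj : Admissible N p m j (dS j) (dXi j)) (hV : PotentialAssumptions Ω V Vinf)
    (z v : X Ω p m) : (hj.form h (bddWeight_const 1) z +
      (admissible_power h).form h hV.bddWeight z) v = formXi j z v + formS j z v + formV V z v := by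
  change hj.form h (bddWeight_const 1) z v + (admissible_power h).form h hV.bddWeight z v = _
  rw [← formS_add_formXi_eq, ← formV_eq h hV, add_comm (formS j z v)]

theorem form_add_form_const_apply {j : ℝ → RN N → ℝ} (h : Exponents N p m)
    (hj : Admissible N p m j (dS j) (dXi j)) (c : ℝ) (z v : X Ω p m) :
    (hj.form h (bddWeight_const 1) z + (admissible_power h).form h (bddWeight_const c) z) v =
      formXi j z v + formS j z v + formV (fun _ => c) z v := by
  change hj.form h (bddWeight_const 1) z v + (admissible_power h).form h (bddWeight_const c) z v = _
  rw [← formS_add_formXi_eq, ← formV_const_eq, add_comm (formS j z v)]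

theorem form_split_apply {j : ℝ → RN N → ℝ} (h : Exponents N p m)
    (hj : Admissible N p m j (dS j) (dXi j)) (z z₁ z₂ v : X Ω p m) :
    (hj.form h (bddWeight_const 1) z - hj.form h (bddWeight_const 1) z₁ +
      hj.form h (bddWeight_const 1) z₂) v = formS j z v + formXi j z v - formS j z₁ v -
        formXi j z₁ v + formS j z₂ v + formXi j z₂ v := by
  change hj.form h (bddWeight_const 1) z v - hj.form h (bddWeight_const 1) z₁ v +
    hj.form h (bddWeight_const 1) z₂ v = _
  rw [← formS_add_formXi_eq, ← formS_add_formXi_eq, ← formS_add_formXi_eq]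
  ring

theorem phi_eq {j : ℝ → RN N → ℝ} (hj0 : j 0 0 = 0) (hp : 0 < p) :
    phi (Ω := Ω) (p := p) (m := m) j V = fun z => (∫ x, (1 : ℝ) * j (val z x) (grad z x)) +
      ∫ x, (Ω : Set (RN N)).indicator V x * (|val z x| ^ p / p) := by
  funext z
  rw [phi, setIntegral_eq_integral_of_ae_compl_eq_zero, setIntegral_eq_integral_of_ae_compl_eq_zero]
  · simp only [one_mul]
    congr 1
    refine integral_congr_ae ?_
    filter_upwards [ae_eq_zero_of_notMem z] with x hx
    by_cases hxΩ : x ∈ (Ω : Set (RN N))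
    · rw [indicator_of_mem hxΩ]
    · rw [(hx hxΩ).1, abs_zero, Real.zero_rpow hp.ne', zero_div, mul_zero, mul_zero]
  · filter_upwards [ae_eq_zero_of_notMem z] with x hx hxΩ
    rw [(hx hxΩ).1, abs_zero, Real.zero_rpow hp.ne', zero_div, mul_zero]
  · filter_upwards [ae_eq_zero_of_notMem z] with x hx hxΩ
    rw [(hx hxΩ).1, (hx hxΩ).2, hj0]

theorem phiInf_eq (j : ℝ → RN N → ℝ) (c : ℝ) :
    phiInf (Ω := Ω) (p := p) (m := m) j c = fun z => (∫ x, (1 : ℝ) * j (val z x) (grad z x)) +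
      ∫ x, c * (|val z x| ^ p / p) := by
  funext z
  simp only [phiInf, one_mul]

theorem integralsConverge {j : ℝ → RN N → ℝ} (h : Exponents N p m)
    (hj : Admissible N p m j (dS j) (dXi j)) (hV : PotentialAssumptions Ω V Vinf)
    (z v : X Ω p m) : IntegralsConverge j V z v := by
  have hp0 : 0 < p := by linarith [h.two_lt_p]
  have hP := admissible_power h
  have h1 : BddWeight (fun _ : RN N => (1 : ℝ)) := bddWeight_const 1
  have hΩ : MeasurableSet (Ω : Set (RN N)) := Ω.isOpen.measurableSet
  refine ⟨?_, ?_, ?_, ?_, ?_, ?_, ?_⟩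
  · simpa using hj.integrable_energy h h1 z
  · rw [← integrable_indicator_iff hΩ]
    refine (hP.integrable_energy h hV.bddWeight z).congr (Eventually.of_forall fun x => ?_)
    by_cases hx : x ∈ (Ω : Set (RN N)) <;> simp [hx]
  · refine ((hP.integrable_energy h h1 z).const_mul p).congr (Eventually.of_forall fun x => ?_)
    simp only [one_mul]
    field_simp
  · simpa using (hj.integrable_X h h1 z v).integrableOn
  · simpa using (hj.integrable_S h h1 z v).integrableOn
  · rw [← integrable_indicator_iff hΩ]
    refine (hP.integrable_S h hV.bddWeight z v).congr (Eventually.of_forall fun x => ?_)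
    by_cases hx : x ∈ (Ω : Set (RN N)) <;> simp [hx, mul_assoc]
  · simpa using (hP.integrable_S h h1 z v).integrableOn

theorem hasFDerivAt_phi {j : ℝ → RN N → ℝ} (h : Exponents N p m)
    (hj : Admissible N p m j (dS j) (dXi j)) (hV : PotentialAssumptions Ω V Vinf) (z : X Ω p m) :
    HasFDerivAt (phi (Ω := Ω) (p := p) (m := m) j V) (hj.form h (bddWeight_const 1) z +
      (admissible_power h).form h hV.bddWeight z) z := by
  rw [phi_eq (hj.apply_zero h) (by linarith [h.two_lt_p])]
  exact (hj.hasFDerivAt_energy h (bddWeight_const 1) z).add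
    ((admissible_power h).hasFDerivAt_energy h hV.bddWeight z)

theorem hasFDerivAt_phiInf {j : ℝ → RN N → ℝ} (h : Exponents N p m)
    (hj : Admissible N p m j (dS j) (dXi j)) (c : ℝ) (z : X Ω p m) :
    HasFDerivAt (phiInf (Ω := Ω) (p := p) (m := m) j c) (hj.form h (bddWeight_const 1) z +
      (admissible_power h).form h (bddWeight_const c) z) z := by
  rw [phiInf_eq]
  exact (hj.hasFDerivAt_energy h (bddWeight_const 1) z).add
    ((admissible_power h).hasFDerivAt_energy h (bddWeight_const c) z)

/-- Replacing `V` by its limit at infinity is harmless along sequences converging to zero almost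
everywhere. -/
theorem tendsto_form_const_sub_form (h : Exponents N p m) (hV : PotentialAssumptions Ω V Vinf)
    {z : ℕ → X Ω p m} {R : ℝ} (hR : ∀ n, ‖z n‖ ≤ R)
    (hz : ∀ᵐ x, Tendsto (fun n => val (z n) x) atTop (𝓝 0)) :
    Tendsto (fun n => (admissible_power h).form h (bddWeight_const Vinf) (z n) -
      (admissible_power h).form h hV.bddWeight (z n)) atTop (𝓝 0) := by
  refine tendsto_dual_zero_of_eventually_le fun ε hε => ?_
  filter_upwards [eventually_integral_decaying_le h (hV.bddWeight_indicator_sub Vinf) hV.decay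
    hR hz hε] with n hn v
  refine le_trans ?_ (hn v)
  rw [sub_apply, Admissible.form_apply, Admissible.form_apply,
    ← integral_sub ((admissible_power h).integrable_pairing h (bddWeight_const Vinf) (z n) v)
      ((admissible_power h).integrable_pairing h hV.bddWeight (z n) v)]
  refine norm_integral_le_of_norm_le
    (integrable_mul_rpow_sub_one_mul h (hV.bddWeight_indicator_sub Vinf) (z n) v) ?_
  filter_upwards [ae_eq_zero_of_notMem v] with x hx
  simp only [pairing, inner_zero_left, add_zero]
  by_cases hxΩ : x ∈ (Ω : Set (RN N))
  · rw [indicator_of_mem hxΩ, indicator_of_mem hxΩ, ← sub_mul, norm_mul, norm_mul, Real.norm_eq_abs,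
      Real.norm_eq_abs, Real.norm_eq_abs, abs_abs_rpow_mul_self h.two_lt_p]
  · rw [(hx hxΩ).1]
    simp

/-- The weak limit of a sequence of almost critical points is a critical point. -/
theorem form_add_form_eq_zero {j : ℝ → RN N → ℝ} (h : Exponents N p m)
    (hj : Admissible N p m j (dS j) (dXi j)) (hV : PotentialAssumptions Ω V Vinf)
    {u : ℕ → X Ω p m} {u₀ : X Ω p m} {R : ℝ} (hR : ∀ n, ‖u n‖ ≤ R)
    (hv : ∀ᵐ x, Tendsto (fun n => val (u n) x) atTop (𝓝 (val u₀ x)))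
    (hg : ∀ᵐ x, Tendsto (fun n => grad (u n) x) atTop (𝓝 (grad u₀ x)))
    {w : ℕ → StrongDual ℝ (X Ω p m)} (hw : Tendsto w atTop (𝓝 0))
    (heq : ∀ n, w n = hj.form h (bddWeight_const 1) (u n) +
      (admissible_power h).form h hV.bddWeight (u n)) :
    hj.form h (bddWeight_const 1) u₀ + (admissible_power h).form h hV.bddWeight u₀ = 0 := by
  refine ContinuousLinearMap.ext fun v => ?_
  have l1 := (hj.tendsto_form_apply h (bddWeight_const 1) hR hv hg v).add
    ((admissible_power h).tendsto_form_apply h hV.bddWeight hR hv hg v)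
  have l2 : Tendsto (fun n => w n v) atTop (𝓝 0) :=
    ((ContinuousLinearMap.apply ℝ ℝ v).continuous.tendsto 0).comp hw
  refine tendsto_nhds_unique l1 (l2.congr fun n => ?_)
  rw [heq n]
  rfl

end Bridge

end QuasiLin

end

theorem theorem3p4 (N : ℕ) (p m σ ν C Vinf : ℝ)
    [Fact (1 ≤ ENNReal.ofReal p)] [Fact (1 ≤ ENNReal.ofReal m)]
    (L : RN N → ℝ) (M : ℝ → RN N → ℝ) (G : ℝ → ℝ)
    (hLMG : QuasiLin.Assumptions N p m σ ν C L M G)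
    (j : ℝ → RN N → ℝ) (hj : j = QuasiLin.jFun L M G)
    (Ω : TopologicalSpace.Opens (RN N)) (V : RN N → ℝ)
    (hV : QuasiLin.PotentialAssumptions Ω V Vinf)
    (u : ℕ → QuasiLin.X Ω p m) (u₀ : QuasiLin.X Ω p m)
    -- weak convergence in the space
    (hweak : ∀ f : StrongDual ℝ (QuasiLin.X Ω p m),
      Tendsto (fun n => f (u n)) atTop (𝓝 (f u₀)))
    -- almost everywhere convergence of the functions and of their gradients
    (hae : ∀ᵐ x ∂(volume.restrict (Ω : Set (RN N))),
      Tendsto (fun n => QuasiLin.val (u n) x) atTop (𝓝 (QuasiLin.val u₀ x)))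
    (hgae : ∀ᵐ x ∂(volume.restrict (Ω : Set (RN N))),
      Tendsto (fun n => QuasiLin.grad (u n) x) atTop (𝓝 (QuasiLin.grad u₀ x)))
    (w : ℕ → StrongDual ℝ (QuasiLin.X Ω p m)) (hw : Tendsto w atTop (𝓝 0))
    (heq : ∀ n, ∀ v : QuasiLin.X Ω p m,
      QuasiLin.formXi j (u n) v + QuasiLin.formS j (u n) v + QuasiLin.formV V (u n) v = w n v) :
    -- the integrals below are genuine
    (∀ z v : QuasiLin.X Ω p m, QuasiLin.IntegralsConverge j V z v) ∧
    -- the limit is a critical point, that is, a weak solution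
    HasFDerivAt (QuasiLin.phi (Ω := Ω) (p := p) (m := m) j V)
      (0 : StrongDual ℝ (QuasiLin.X Ω p m)) u₀ ∧
    (∀ v : QuasiLin.X Ω p m,
      QuasiLin.formXi j u₀ v + QuasiLin.formS j u₀ v + QuasiLin.formV V u₀ v = 0) ∧
    -- splitting of the derivative terms
    (∃ ξ : ℕ → StrongDual ℝ (QuasiLin.X Ω p m), Tendsto ξ atTop (𝓝 0) ∧
      ∀ n, ∀ v : QuasiLin.X Ω p m,
        ξ n v = QuasiLin.formS j (u n - u₀) v + QuasiLin.formXi j (u n - u₀) v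
          - QuasiLin.formS j (u n) v - QuasiLin.formXi j (u n) v
          + QuasiLin.formS j u₀ v + QuasiLin.formXi j u₀ v) ∧
    -- the derivative of the limiting functional along the differences tends to zero
    (∃ ζ : ℕ → StrongDual ℝ (QuasiLin.X Ω p m), Tendsto ζ atTop (𝓝 0) ∧
      (∀ n, ∀ v : QuasiLin.X Ω p m,
        QuasiLin.formXi j (u n - u₀) v + QuasiLin.formS j (u n - u₀) v
          + QuasiLin.formV (fun _ => Vinf) (u n - u₀) v = ζ n v) ∧
      ∀ n, HasFDerivAt (QuasiLin.phiInf (Ω := Ω) (p := p) (m := m) j Vinf)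
        (ζ n) (u n - u₀)) := by
  have h := hLMG.exponents
  subst hj
  have hj := hLMG.admissible_jFun
  have hP := QuasiLin.admissible_power h
  have h1 : QuasiLin.BddWeight (fun _ : RN N => (1 : ℝ)) := QuasiLin.bddWeight_const 1
  obtain ⟨R, hR⟩ := QuasiLin.exists_norm_le_of_weak_tendsto hweak
  have hv : ∀ᵐ x, Tendsto (fun n => QuasiLin.val (u n) x) atTop (𝓝 (QuasiLin.val u₀ x)) := by
    rw [ae_restrict_iff' Ω.isOpen.measurableSet] at hae
    filter_upwards [hae, ae_all_iff.2 fun n => QuasiLin.ae_eq_zero_of_notMem (u n),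
      QuasiLin.ae_eq_zero_of_notMem u₀] with x a1 a2 a3
    by_cases hx : x ∈ (Ω : Set (RN N))
    · exact a1 hx
    · simp only [(a2 _ hx).1, (a3 hx).1]
      exact tendsto_const_nhds
  have hg : ∀ᵐ x, Tendsto (fun n => QuasiLin.grad (u n) x) atTop (𝓝 (QuasiLin.grad u₀ x)) := by
    rw [ae_restrict_iff' Ω.isOpen.measurableSet] at hgae
    filter_upwards [hgae, ae_all_iff.2 fun n => QuasiLin.ae_eq_zero_of_notMem (u n),
      QuasiLin.ae_eq_zero_of_notMem u₀] with x a1 a2 a3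
    by_cases hx : x ∈ (Ω : Set (RN N))
    · exact a1 hx
    · simp only [(a2 _ hx).2, (a3 hx).2]
      exact tendsto_const_nhds
  have hd : ∀ᵐ x, Tendsto (fun n => QuasiLin.val (u n - u₀) x) atTop (𝓝 0) := by
    filter_upwards [hv, ae_all_iff.2 fun n => QuasiLin.val_sub (u n) u₀] with x a1 a2
    simp only [a2]
    simpa using a1.sub_const (QuasiLin.val u₀ x)
  have hRd : ∀ n, ‖u n - u₀‖ ≤ R + ‖u₀‖ := fun n =>
    (norm_sub_le _ _).trans (by linarith [hR n])
  have hw' : ∀ n, w n = hj.form h h1 (u n) + hP.form h hV.bddWeight (u n) := fun n =>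
    ContinuousLinearMap.ext fun v =>
      (heq n v).symm.trans (QuasiLin.form_add_form_apply h hj hV (u n) v).symm
  have crit : hj.form h h1 u₀ + hP.form h hV.bddWeight u₀ = 0 :=
    QuasiLin.form_add_form_eq_zero h hj hV hR hv hg hw hw'
  have split := hj.tendsto_form_split h h1 hR hv hg
  refine ⟨fun z v => QuasiLin.integralsConverge h hj hV z v, ?_, fun v => ?_,
    ⟨_, split, fun n v => ?_⟩,
    ⟨fun n => hj.form h h1 (u n - u₀) + hP.form h (QuasiLin.bddWeight_const Vinf) (u n - u₀),
      ?_, fun n v => ?_, fun n => QuasiLin.hasFDerivAt_phiInf h hj Vinf (u n - u₀)⟩⟩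
  · rw [← crit]
    exact QuasiLin.hasFDerivAt_phi h hj hV u₀
  · exact (QuasiLin.form_add_form_apply h hj hV u₀ v).symm.trans (congrArg (fun f => f v) crit)
  · exact QuasiLin.form_split_apply h hj (u n - u₀) (u n) u₀ v
  · have splitV := hP.tendsto_form_split h hV.bddWeight hR hv hg
    have far := QuasiLin.tendsto_form_const_sub_form h hV hRd hd
    exact QuasiLin.tendsto_dual_add_zero split hw splitV far hw' crit
  · exact (QuasiLin.form_add_form_const_apply h hj Vinf (u n - u₀) v).symm
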